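/- Consider the two-user MISO broadcast channel with $m$ transmit antennas and single-antenna receivers, $y_t=h_t^{\mathsf T}x_t+e_t$, $z_t=g_t^{\mathsf T}x_t+b_t$, where the noise samples $e_t,b_t$ are i.i.d. $\mathcal{CN}(0,1)$ and independent of the messages and of the channel, and $\mathbb E\|x_t\|^2\le P$ for every $t$. At each time $t$ the channel vectors $h_t,g_t\in\mathbb C^m$ are independent and identically distributed with zero mean and covariance $I_m$, their joint law (over time) does not depend on $P$, and the state $S_t=[h_t\ g_t]^{\mathsf T}$ has rank $2$ almost surely. For each $P>0$ there are estimates $\hat h_t,\hat g_t$ of the current channel such that $\hat h_t$ and $h_t-\hat h_t$ (likewise $\hat g_t$ and $g_t-\hat g_t$) are uncorrelated, with zero mean and covariances $(1-\sigma^2)I_m$ and $\sigma^2I_m$, where $0\le\sigma^2=\sigma^2(P)\le1$. At time $t$ the transmitter knows $S_1,\dots,S_{t-1}$ (perfect delayed CSIT) and the estimates up to time $t$ (imperfect current CSIT); the receivers know all states and estimates. Assume that $\alpha=\lim_{P\to\infty}\alpha_P\in[0,\infty]$ exists, where $\alpha_P=-\log\sigma^2/\log P$ (with $\alpha_P=\infty$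 if $\sigma^2=0$). For a fixed length $L\ge 1$, let $\mathsf{DoF}_L$ be the supremum of all $r$ for which there is a family of codes of length $L$, indexed by $P$, carrying one private message per user at a common rate $R(P)$ bits per channel use, with $\lim_{P\to\infty}R(P)/\log_2P=r$, and such that the average probability that some user decodes its message wrongly tends to $0$ as $P\to\infty$. Say that $d$ degrees of freedom per user are achievable if $\mathsf{DoF}_L\ge d$ for some $L$. Then the following DoF is achievable for each user (simultaneously): $$d=\begin{cases}\dfrac{2-\alpha}{3-2\alpha}, & \alpha\in[0,1],\\[1ex] 1, & \alpha>1.\end{cases}$$ -/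

import Mathlib

open MeasureTheory ProbabilityTheory Filter Topology
open scoped ENNReal

noncomputable section

namespace MISO

/-- A channel state: the `2 × m` matrix whose row `0` is the channel vector `h` of user 1 and
whose row `1` is the channel vector `g` of user 2. -/
abbrev State (m : ℕ) : Type := Fin 2 → Fin m → ℂ

/-- The circularly symmetric complex Gaussian law `CN(0,1)`: independent real and imaginary
parts, each `N(0, 1/2)`. -/
def stdComplexGaussian : Measure ℂ :=
  ((gaussianReal 0 (1 / 2)).prod (gaussianReal 0 (1 / 2))).map (fun p : ℝ × ℝ => ⟨p.1, p.2⟩)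

/-- The law of the additive noise over `L` channel uses: all the samples, over users and times,
are independent and `CN(0,1)`. -/
def noiseLaw (L : ℕ) : Measure (Fin 2 → Fin L → ℂ) :=
  Measure.pi fun _ => Measure.pi fun _ => stdComplexGaussian

/-- `X` is a square-integrable, centred random vector with covariance matrix `v • I`. -/
structure CenteredWhite {Ω : Type*} [MeasurableSpace Ω] (μ : Measure Ω) {m : ℕ}
    (X : Ω → Fin m → ℂ) (v : ℝ) : Prop where
  memLp : ∀ i, MemLp (fun ω => X ω i) 2 μ
  mean : ∀ i, ∫ ω, X ω i ∂μ = 0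
  cov : ∀ i j, ∫ ω, X ω i * star (X ω j) ∂μ = if i = j then (v : ℂ) else 0

/-- Mutually independent fading. At each time the channel vectors of the two users are
independent, identically distributed, centred with identity covariance, and the state matrix
has rank two almost surely. Nothing is assumed on the dependence between different times. -/
structure IndependentFading {Ω : Type*} [MeasurableSpace Ω] (μ : Measure Ω) {m : ℕ}
    (S : ℕ → Ω → State m) : Prop where
  measurable : ∀ t, Measurable (S t)
  indep : ∀ t, IndepFun (fun ω => S t ω 0) (fun ω => S t ω 1) μ
  ident : ∀ t, IdentDistrib (fun ω => S t ω 0) (fun ω => S t ω 1) μ μ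
  white : ∀ t k, CenteredWhite μ (fun ω => S t ω k) 1
  rank : ∀ t, ∀ᵐ ω ∂μ, (Matrix.of (S t ω)).rank = 2

/-- Imperfect current channel knowledge of quality `σ2`. At each time the estimate of each user's
channel and the estimation error are centred, uncorrelated, and have covariance
`(1 - σ2) • I` and `σ2 • I`. -/
structure ImperfectEstimate {Ω : Type*} [MeasurableSpace Ω] (μ : Measure Ω) {m : ℕ}
    (S Shat : ℕ → Ω → State m) (σ2 : ℝ) : Prop where
  measurable : ∀ t, Measurable (Shat t)
  nonneg : 0 ≤ σ2
  le_one : σ2 ≤ 1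
  estimate : ∀ t k, CenteredWhite μ (fun ω => Shat t ω k) (1 - σ2)
  error : ∀ t k, CenteredWhite μ (fun ω => S t ω k - Shat t ω k) σ2
  uncorrelated : ∀ t k i j,
    ∫ ω, Shat t ω k i * star (S t ω k j - Shat t ω k j) ∂μ = 0

/-- The power exponent `α_P = - log σ² / log P` of the estimation error, equal to `+∞` when the
estimation error vanishes. -/
def errorExponent (σ2 P : ℝ) : EReal :=
  if σ2 = 0 then ⊤ else ((-Real.log σ2 / Real.log P : ℝ) : EReal)

/-- A code of length `L` for two private messages, each from a set of size `M`.
The channel input at time `t` depends on the two messages, on the states strictly before `t`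
(delayed CSIT) and on the estimates up to and including time `t` (current CSIT). Receiver `k`
decodes from its own outputs, all the states and all the estimates. -/
structure Code (m L M : ℕ) where
  enc : (t : Fin L) → (Fin 2 → Fin M) → (Fin (t : ℕ) → State m) → (Fin ((t : ℕ) + 1) → State m) →
    (Fin m → ℂ)
  dec : Fin 2 → (Fin L → ℂ) → (Fin L → State m) → (Fin L → State m) → Fin M
  measurable_enc : ∀ (t : Fin L) (w : Fin 2 → Fin M), Measurable
    (fun p : (Fin (t : ℕ) → State m) × (Fin ((t : ℕ) + 1) → State m) => enc t w p.1 p.2)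
  measurable_dec : ∀ k, Measurable
    (fun p : (Fin L → ℂ) × (Fin L → State m) × (Fin L → State m) => dec k p.1 p.2.1 p.2.2)

namespace Code

variable {m L M : ℕ}

/-- The channel input at time `t` for the messages `w`, the states `s` and the estimates `shat`. -/
def input (c : Code m L M) (w : Fin 2 → Fin M) (s shat : ℕ → State m) (t : Fin L) : Fin m → ℂ :=
  c.enc t w (fun τ => s τ) (fun τ => shat τ)

/-- The outputs of receiver `k`: the product of its channel row with the input, plus noise. -/
def output (c : Code m L M) (w : Fin 2 → Fin M) (s shat : ℕ → State m)
    (n : Fin 2 → Fin L → ℂ) (k : Fin 2) (t : Fin L) : ℂ :=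
  (∑ i, s t k i * c.input w s shat t i) + n k t

/-- The message decoded by receiver `k`. -/
def decoded (c : Code m L M) (w : Fin 2 → Fin M) (s shat : ℕ → State m)
    (n : Fin 2 → Fin L → ℂ) (k : Fin 2) : Fin M :=
  c.dec k (c.output w s shat n k) (fun t => s t) (fun t => shat t)

/-- The average power `E ‖x_t‖²`, over uniform messages and over the channel. -/
def avgPower (c : Code m L M) {Ω : Type*} [MeasurableSpace Ω] (μ : Measure Ω)
    (S Shat : ℕ → Ω → State m) (t : Fin L) : ℝ≥0∞ :=
  (∑ w : Fin 2 → Fin M,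
    ∫⁻ ω, ∑ i, ‖c.input w (fun τ => S τ ω) (fun τ => Shat τ ω) t i‖ₑ ^ 2 ∂μ) / (M : ℝ≥0∞) ^ 2

/-- The average probability that at least one receiver decodes its message wrongly: the messages
are uniform and messages, channel (with its estimates) and noise are independent. -/
def errorProb (c : Code m L M) {Ω : Type*} [MeasurableSpace Ω] (μ : Measure Ω)
    (S Shat : ℕ → Ω → State m) : ℝ≥0∞ :=
  (∑ w : Fin 2 → Fin M, (μ.prod (noiseLaw L))
    {p | ∃ k, c.decoded w (fun τ => S τ p.1) (fun τ => Shat τ p.1) p.2 k ≠ w k}) / (M : ℝ≥0∞) ^ 2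

end Code

/-- The per-user pre-log factor `r` is reliably supported by codes of length `L`: there is a family
of codes, indexed by the power `P`, with input power at most `P` at each time, the same rate
`R(P) = log₂ M(P) / L` bits per channel use for both users, `R(P) / log₂ P → r`, and vanishing
error probability. The fading process `S` does not depend on `P`; the estimate `Shat P` does. -/
def ReliablePrelog {Ω : Type*} [MeasurableSpace Ω] (μ : Measure Ω) {m : ℕ}
    (S : ℕ → Ω → State m) (Shat : ℝ → ℕ → Ω → State m) (L : ℕ) (r : ℝ) : Prop :=
  ∃ (M : ℝ → ℕ) (c : ∀ P : ℝ, Code m L (M P)),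
    (∀ P, 0 < P → 0 < M P) ∧
    (∀ P, 0 < P → ∀ t, (c P).avgPower μ S (Shat P) t ≤ ENNReal.ofReal P) ∧
    Tendsto (fun P => (Real.logb 2 (M P) / L) / Real.logb 2 P) atTop (𝓝 r) ∧
    Tendsto (fun P => (c P).errorProb μ S (Shat P)) atTop (𝓝 0)

/-- The degrees of freedom per user of codes of length `L`: the supremum of the reliable pre-log
factors. -/
def dof {Ω : Type*} [MeasurableSpace Ω] (μ : Measure Ω) {m : ℕ}
    (S : ℕ → Ω → State m) (Shat : ℝ → ℕ → Ω → State m) (L : ℕ) : EReal :=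
  sSup ((fun r : ℝ => (r : EReal)) '' {r | ReliablePrelog μ S Shat L r})

/-- `d` degrees of freedom per user are achievable, by codes of some fixed length. -/
def AchievableDoF {Ω : Type*} [MeasurableSpace Ω] (μ : Measure Ω) {m : ℕ}
    (S : ℕ → Ω → State m) (Shat : ℝ → ℕ → Ω → State m) (d : ℝ) : Prop :=
  ∃ L : ℕ, 0 < L ∧ (d : EReal) ≤ dof μ S Shat L

end MISO

end

/-! A three-slot code reaches `(2 + β) / 3` degrees of freedom per user for every `β` in the unit
interval with `β ≤ α`. At `β = α ≤ 1` this is at least the claimed value, and at `β = 1` it equals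
1.

Put `X = P ^ (β / 2)` and `Y = P ^ ((1 - β) / 2)`, so that `X * Y` is the full amplitude `√P`. Let
`K = P ^ ε` be slack that absorbs noise, channel fluctuations and constants. In the first slot each
user receives a symbol of amplitude about `X * Y`, zero-forced at the other user by means of the
estimates, and an unprotected symbol of amplitude about `Y`. The zero-forcing leakage is about `1 /
X`, so the interference at either receiver has amplitude only about `Y`. The transmitter learns the
first state afterwards and can compute both interferences. Rounded to Gaussian integers, they take
about `Y ^ 2` values each. Each of the two later slots sends one of them as a common symbol above
the level `X`, and below that level a new zero-forced symbol of amplitude about `X` for each user,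
which leaks to the other user at a bounded level. Both interferences serve both users: a receiver
cancels the one it suffered, and the other is a second linear equation in its own two first-slot
symbols. The exponents `1 + (1 - β) + β + β` of a user's four constellation sizes sum to `2 + β`,
spread over three slots.

The deterministic core is `WellConditioned.layered_separation` and `WellConditioned.mix_separation`:
outputs within `2 * K` of each other force equal symbols. `exists_code_of_encoder` turns this into a
decoder, and `Code.errorProb_le` reduces the error to channel outage plus large noise.
`IndependentFading.exists_beams` reduces `m` antennas to two by fixed generic beams. In
`exists_estimator` outage vanishes: the fading law is fixed while `K → ∞`, and Chebyshev's
inequality controls the estimation errors. Letting `ε → 0` and then `β` increase to its limit gives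
`le_dof`. -/

noncomputable section

namespace MISO

/-! ### Two effective antennas: the deterministic analysis -/

/-- The bilinear pairing of an effective channel with an effective input. -/
def pairing (p q : ℂ × ℂ) : ℂ := p.1 * q.1 + p.2 * q.2

/-- The determinant of two effective channels. -/
def cross (p q : ℂ × ℂ) : ℂ := p.1 * q.2 - p.2 * q.1

/-- The zero-forcing direction of an effective channel. -/
def zeroForcing (q : ℂ × ℂ) : ℂ × ℂ := (q.2, -q.1)

/-- Rounding down of a complex number to a Gaussian integer. -/
def gaussFloor (z : ℂ) : GaussianInt := ⟨⌊z.re⌋, ⌊z.im⌋⟩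

/-- The two symbols of user `l` sent in the first slot: one is zero-forced at the other user. -/
def stream (K : ℝ) (E : Fin 2 → ℂ × ℂ) (z : Fin 2 → Fin 4 → GaussianInt) (l : Fin 2) : ℂ × ℂ :=
  ((K : ℂ) ^ 6) • ((z l 0 : ℂ) • zeroForcing (E (1 - l)) + (z l 1 : ℂ) • ((1, 0) : ℂ × ℂ))

/-- The quantized interference at receiver `k` in the first slot. -/
def overheard (K : ℝ) (H E : Fin 2 → ℂ × ℂ) (z : Fin 2 → Fin 4 → GaussianInt) (k : Fin 2) :
    GaussianInt :=
  gaussFloor (pairing (H k) (stream K E z (1 - k)))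

/-- The effective input of the first slot. -/
def mixInput (K : ℝ) (E : Fin 2 → ℂ × ℂ) (z : Fin 2 → Fin 4 → GaussianInt) : ℂ × ℂ :=
  ∑ l, stream K E z l

/-- The effective input of a later slot: a common symbol `c` superposed on one zero-forced private
symbol of each user. -/
def layeredInput (K X : ℝ) (E : Fin 2 → ℂ × ℂ) (c : GaussianInt) (p : Fin 2 → GaussianInt) :
    ℂ × ℂ :=
  ((K : ℂ) ^ 3 * X * c) • ((1, 0) : ℂ × ℂ) +
    ∑ l, ((K : ℂ) ^ 6 * p l) • zeroForcing (E (1 - l))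

/-- The effective channels `H` and their estimates `E` are bounded by `K`, bounded away from
degeneracy by `1 / K`, and the leakage through the zero-forcing directions is at most
`K ^ 2 / X`. -/
structure WellConditioned (K X : ℝ) (H E : Fin 2 → ℂ × ℂ) : Prop where
  fst_le : ∀ k, ‖(H k).1‖ ≤ K
  snd_le : ∀ k, ‖(H k).2‖ ≤ K
  est_fst_le : ∀ k, ‖(E k).1‖ ≤ K
  est_snd_le : ∀ k, ‖(E k).2‖ ≤ K
  fst_ge : ∀ k, 1 ≤ K * ‖(H k).1‖
  est_fst_ge : ∀ k, 1 ≤ K * ‖(E k).1‖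
  cross_ge : 1 ≤ K * ‖cross (H 0) (H 1)‖
  direct_ge : ∀ k, 1 ≤ K * ‖cross (H k) (E (1 - k))‖
  leak_le : ∀ k, X * ‖cross (H k) (E k)‖ ≤ K ^ 2

/-- Size constraints on the symbols of both users. -/
structure SymbolBound (K X Y : ℝ) (z : Fin 2 → Fin 4 → GaussianInt) : Prop where
  forced : ∀ l, ‖(z l 0 : ℂ)‖ ≤ 2 * (X * Y) / K ^ 16
  free : ∀ l, ‖(z l 1 : ℂ)‖ ≤ 2 * Y / K ^ 16
  layered : ∀ l (j : Fin 2), ‖(z l j.succ.succ : ℂ)‖ ≤ 2 * X / K ^ 16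

/-! ### Received signals, and the spacing of Gaussian integers. -/

lemma pairing_add (p q r : ℂ × ℂ) : pairing p (q + r) = pairing p q + pairing p r := by
  simp only [pairing, Prod.fst_add, Prod.snd_add]; ring

lemma pairing_smul (c : ℂ) (p q : ℂ × ℂ) : pairing p (c • q) = c * pairing p q := by
  simp only [pairing, Prod.smul_fst, Prod.smul_snd, smul_eq_mul]; ring

lemma pairing_zeroForcing (p q : ℂ × ℂ) : pairing p (zeroForcing q) = cross p q := by
  simp only [pairing, zeroForcing, cross]; ring

lemma pairing_one_zero (p : ℂ × ℂ) : pairing p (1, 0) = p.1 := by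
  simp [pairing]

lemma one_sub_one_sub (k : Fin 2) : 1 - (1 - k) = k := by fin_cases k <;> rfl

lemma sum_eq_self_add_other {A : Type*} [AddCommMonoid A] (f : Fin 2 → A) (k : Fin 2) :
    ∑ l, f l = f k + f (1 - k) := by
  fin_cases k
  · simp [Fin.sum_univ_two]
  · simp [Fin.sum_univ_two, add_comm]

lemma pairing_stream (K : ℝ) (E : Fin 2 → ℂ × ℂ) (z : Fin 2 → Fin 4 → GaussianInt) (l : Fin 2)
    (p : ℂ × ℂ) : pairing p (stream K E z l) =
      (K : ℂ) ^ 6 * (z l 0 * cross p (E (1 - l)) + z l 1 * p.1) := by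
  rw [stream, pairing_smul, pairing_add, pairing_smul, pairing_smul, pairing_zeroForcing,
    pairing_one_zero]

lemma pairing_layeredInput (K X : ℝ) (E : Fin 2 → ℂ × ℂ) (c : GaussianInt)
    (p : Fin 2 → GaussianInt) (q : ℂ × ℂ) (k : Fin 2) : pairing q (layeredInput K X E c p) =
      (K : ℂ) ^ 3 * X * c * q.1 + (K : ℂ) ^ 6 * p k * cross q (E (1 - k))
        + (K : ℂ) ^ 6 * p (1 - k) * cross q (E k) := by
  rw [layeredInput, sum_eq_self_add_other _ k, pairing_add, pairing_add, pairing_smul,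
    pairing_smul, pairing_smul, pairing_zeroForcing, pairing_zeroForcing, pairing_one_zero,
    one_sub_one_sub, add_assoc]

lemma pairing_mixInput (K : ℝ) (E : Fin 2 → ℂ × ℂ) (z : Fin 2 → Fin 4 → GaussianInt) (k : Fin 2)
    (p : ℂ × ℂ) : pairing p (mixInput K E z) =
      pairing p (stream K E z k) + pairing p (stream K E z (1 - k)) := by
  rw [mixInput, sum_eq_self_add_other _ k, pairing_add]

/-- The squared modulus of a nonzero Gaussian integer is a positive integer, hence at least 1. -/
lemma gaussianInt_eq_of_norm_sub_lt_one {x y : GaussianInt} (h : ‖(x : ℂ) - y‖ < 1) : x = y := by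
  rw [← sub_eq_zero]
  by_contra hne
  have h1 : (1 : ℤ) ≤ Zsqrtd.norm (x - y) := GaussianInt.norm_pos.2 hne
  have h2 : ((Zsqrtd.norm (x - y) : ℤ) : ℝ) = ‖(x : ℂ) - y‖ ^ 2 := by
    rw [GaussianInt.intCast_real_norm, Complex.normSq_eq_norm_sq, map_sub]
  have h3 : (1 : ℝ) ≤ ‖(x : ℂ) - y‖ ^ 2 := by rw [← h2]; exact_mod_cast h1
  nlinarith [norm_nonneg ((x : ℂ) - y)]

lemma norm_sub_gaussFloor_le (z : ℂ) : ‖z - gaussFloor z‖ ≤ 2 := by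
  refine (Complex.norm_le_abs_re_add_abs_im _).trans ?_
  have h1 : (z - gaussFloor z).re = Int.fract z.re := by
    simp [gaussFloor, GaussianInt.toComplex_def]
  have h2 : (z - gaussFloor z).im = Int.fract z.im := by
    simp [gaussFloor, GaussianInt.toComplex_def]
  rw [h1, h2, abs_of_nonneg (Int.fract_nonneg _), abs_of_nonneg (Int.fract_nonneg _)]
  linarith [Int.fract_lt_one z.re, Int.fract_lt_one z.im]

lemma norm_sub_le_of_gaussFloor_eq {z w : ℂ} (h : gaussFloor z = gaussFloor w) :
    ‖z - w‖ ≤ 4 := by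
  have h1 := norm_sub_gaussFloor_le z
  have h2 := norm_sub_gaussFloor_le w
  calc ‖z - w‖ = ‖(z - gaussFloor z) - (w - gaussFloor w)‖ := by rw [h]; congr 1; ring
    _ ≤ 2 + 2 := (norm_sub_le _ _).trans (add_le_add h1 h2)
    _ = 4 := by norm_num

/-- A Gaussian integer difference that is multiplied by a gain of at least `G` and observed up to
an error smaller than `G` vanishes. -/
lemma gaussianInt_eq_of_norm_mul_sub_lt {x y : GaussianInt} {g : ℂ} {G e : ℝ} (hG : G ≤ ‖g‖)
    (h : ‖g * ((x : ℂ) - y)‖ ≤ e) (he : e < G) : x = y := by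
  apply gaussianInt_eq_of_norm_sub_lt_one
  by_contra! hc
  rw [norm_mul] at h
  nlinarith [norm_nonneg g]

/-! ### Resolving the symbols from nearly equal outputs. -/

variable {K X Y : ℝ} {H E : Fin 2 → ℂ × ℂ}

lemma WellConditioned.norm_cross_le (h : WellConditioned K X H E) (hK : 0 ≤ K) (k l : Fin 2) :
    ‖cross (H k) (E l)‖ ≤ 2 * K ^ 2 := by
  refine (norm_sub_le _ _).trans ?_
  rw [norm_mul, norm_mul]
  have := mul_le_mul (h.fst_le k) (h.est_snd_le l) (norm_nonneg _) hK
  have := mul_le_mul (h.snd_le k) (h.est_fst_le l) (norm_nonneg _) hK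
  nlinarith

lemma norm_cross_comm (p q : ℂ × ℂ) : ‖cross p q‖ = ‖cross q p‖ := by
  rw [← norm_neg]; congr 1; simp only [cross]; ring

lemma WellConditioned.norm_cross_ge (h : WellConditioned K X H E) (k : Fin 2) :
    1 ≤ K * ‖cross (H k) (H (1 - k))‖ := by
  fin_cases k
  · simpa using h.cross_ge
  · simpa [norm_cross_comm (H 1)] using h.cross_ge

/-- In a later slot, a receiver resolves the common symbol and its private symbol. -/
lemma WellConditioned.layered_separation (h : WellConditioned K X H E) (hK : 8 ≤ K) (hX : 1 ≤ X)
    {c c' : GaussianInt} {p p' : Fin 2 → GaussianInt}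
    (hp : ∀ l, ‖(p l : ℂ)‖ ≤ 2 * X / K ^ 16) (hp' : ∀ l, ‖(p' l : ℂ)‖ ≤ 2 * X / K ^ 16)
    (k : Fin 2)
    (hd : ‖pairing (H k) (layeredInput K X E c p) - pairing (H k) (layeredInput K X E c' p')‖
      ≤ 2 * K) : c = c' ∧ p k = p' k := by
  have hK0 : 0 < K := by linarith
  have hX0 : 0 < X := by linarith
  have hdp : ∀ l, ‖(p l : ℂ) - p' l‖ ≤ 4 * X / K ^ 16 := fun l =>
    (norm_sub_le _ _).trans ((add_le_add (hp l) (hp' l)).trans_eq (by ring))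
  have hnK : ‖(K : ℂ)‖ = K := by rw [Complex.norm_real, Real.norm_of_nonneg hK0.le]
  have hnX : ‖(X : ℂ)‖ = X := by rw [Complex.norm_real, Real.norm_of_nonneg hX0.le]
  have hpriv : ∀ l q, ‖(K : ℂ) ^ 6 * cross (H k) (E q) * ((p l : ℂ) - p' l)‖ ≤ X := by
    intro l q
    rw [norm_mul, norm_mul, norm_pow, hnK]
    calc K ^ 6 * ‖cross (H k) (E q)‖ * ‖(p l : ℂ) - p' l‖
        ≤ K ^ 6 * (2 * K ^ 2) * (4 * X / K ^ 16) := by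
          gcongr
          · exact h.norm_cross_le hK0.le k q
          · exact hdp l
      _ = 8 * X / K ^ 8 := by field_simp; ring
      _ ≤ X := by
          rw [div_le_iff₀ (by positivity)]
          have : 8 ≤ K ^ 8 := hK.trans (le_self_pow₀ (by linarith) (by norm_num))
          nlinarith
  rw [pairing_layeredInput _ _ _ _ _ _ k, pairing_layeredInput _ _ _ _ _ _ k] at hd
  -- Both private terms count as noise, of size `X` each. The common lattice has spacing at least `K
  -- ^ 3 * X / K`, which exceeds `2 * K + 2 * X`.
  have hc : c = c' := by
    refine gaussianInt_eq_of_norm_mul_sub_lt (g := (K : ℂ) ^ 3 * X * (H k).1) (G := K ^ 2 * X)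
      (e := 2 * K + X + X) ?_ ?_ ?_
    · rw [norm_mul, norm_mul, norm_pow, hnK, hnX]
      nlinarith [mul_le_mul_of_nonneg_left (h.fst_ge k) (by positivity : 0 ≤ K ^ 2 * X)]
    · calc _ = ‖((K : ℂ) ^ 3 * X * c * (H k).1 + (K : ℂ) ^ 6 * p k * cross (H k) (E (1 - k))
          + (K : ℂ) ^ 6 * p (1 - k) * cross (H k) (E k)
          - ((K : ℂ) ^ 3 * X * c' * (H k).1 + (K : ℂ) ^ 6 * p' k * cross (H k) (E (1 - k))
          + (K : ℂ) ^ 6 * p' (1 - k) * cross (H k) (E k)))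
          - (K : ℂ) ^ 6 * cross (H k) (E (1 - k)) * ((p k : ℂ) - p' k)
          - (K : ℂ) ^ 6 * cross (H k) (E k) * ((p (1 - k) : ℂ) - p' (1 - k))‖ := by
            congr 1; ring
        _ ≤ _ := (norm_sub_le _ _).trans (add_le_add ((norm_sub_le _ _).trans
            (add_le_add hd (hpriv _ _))) (hpriv _ _))
    · nlinarith [mul_le_mul hX hK (by norm_num) hX0.le]
  refine ⟨hc, ?_⟩
  subst hc
  -- With the common symbol removed, the own private symbol has spacing at least `K ^ 6 / K`, while
  -- the other user's symbol leaks at most 1.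
  refine gaussianInt_eq_of_norm_mul_sub_lt (g := (K : ℂ) ^ 6 * cross (H k) (E (1 - k)))
    (G := K ^ 5) (e := 2 * K + 1) ?_ ?_ ?_
  · rw [norm_mul, norm_pow, hnK]
    nlinarith [mul_le_mul_of_nonneg_left (h.direct_ge k) (by positivity : 0 ≤ K ^ 5)]
  · have hleak : ‖(K : ℂ) ^ 6 * cross (H k) (E k) * ((p (1 - k) : ℂ) - p' (1 - k))‖ ≤ 1 := by
      rw [norm_mul, norm_mul, norm_pow, hnK]
      calc K ^ 6 * ‖cross (H k) (E k)‖ * ‖(p (1 - k) : ℂ) - p' (1 - k)‖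
          ≤ K ^ 6 * (K ^ 2 / X) * (4 * X / K ^ 16) := by
            gcongr
            · rw [le_div_iff₀' hX0]; exact h.leak_le k
            · exact hdp _
        _ = 4 / K ^ 8 := by field_simp
        _ ≤ 1 := by
            rw [div_le_iff₀ (by positivity)]
            have : 8 ≤ K ^ 8 := hK.trans (le_self_pow₀ (by linarith) (by norm_num))
            linarith
    calc _ = ‖((K : ℂ) ^ 3 * X * c * (H k).1 + (K : ℂ) ^ 6 * p k * cross (H k) (E (1 - k))
          + (K : ℂ) ^ 6 * p (1 - k) * cross (H k) (E k)
          - ((K : ℂ) ^ 3 * X * c * (H k).1 + (K : ℂ) ^ 6 * p' k * cross (H k) (E (1 - k))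
          + (K : ℂ) ^ 6 * p' (1 - k) * cross (H k) (E k)))
          - (K : ℂ) ^ 6 * cross (H k) (E k) * ((p (1 - k) : ℂ) - p' (1 - k))‖ := by
            congr 1; ring
      _ ≤ _ := (norm_sub_le _ _).trans (add_le_add hd hleak)
  · have : K ^ 2 ≤ K ^ 5 := pow_le_pow_right₀ (by linarith) (by norm_num)
    nlinarith

/-- In the first slot, a receiver which knows the quantized interference at both receivers
resolves its two symbols. -/
lemma WellConditioned.mix_separation (h : WellConditioned K X H E) (hK : 8 ≤ K)
    {z z' : Fin 2 → Fin 4 → GaussianInt} (k : Fin 2)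
    (hc : ∀ l, overheard K H E z l = overheard K H E z' l)
    (hd : ‖pairing (H k) (mixInput K E z) - pairing (H k) (mixInput K E z')‖ ≤ 2 * K) :
    z k 0 = z' k 0 ∧ z k 1 = z' k 1 := by
  have hK0 : 0 < K := by linarith
  have hnK : ‖(K : ℂ)‖ = K := by rw [Complex.norm_real, Real.norm_of_nonneg hK0.le]
  have hi : ‖pairing (H k) (stream K E z (1 - k)) - pairing (H k) (stream K E z' (1 - k))‖ ≤ 4 :=
    norm_sub_le_of_gaussFloor_eq (hc k)
  have h2 : ‖pairing (H (1 - k)) (stream K E z k) - pairing (H (1 - k)) (stream K E z' k)‖ ≤ 4 := by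
    have := norm_sub_le_of_gaussFloor_eq (hc (1 - k))
    rwa [one_sub_one_sub] at this
  have h1 : ‖pairing (H k) (stream K E z k) - pairing (H k) (stream K E z' k)‖ ≤ 2 * K + 4 := by
    rw [pairing_mixInput _ _ _ k, pairing_mixInput _ _ _ k] at hd
    calc _ = ‖(pairing (H k) (stream K E z k) + pairing (H k) (stream K E z (1 - k))
          - (pairing (H k) (stream K E z' k) + pairing (H k) (stream K E z' (1 - k))))
          - (pairing (H k) (stream K E z (1 - k)) - pairing (H k) (stream K E z' (1 - k)))‖ := by
            congr 1; ring
      _ ≤ _ := (norm_sub_le _ _).trans (add_le_add hd hi)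
  rw [pairing_stream, pairing_stream] at h1 h2
  have h0 : z k 0 = z' k 0 := by
    -- Eliminate the unprotected symbol: weight the equation at receiver `k` by `(H (1 - k)).1`, the
    -- one at the other receiver by `(H k).1`, and subtract. The zero-forced symbol is left with
    -- coefficient `(E (1 - k)).1 * cross (H k) (H (1 - k))`, of modulus at least `1 / K ^ 2`, up to
    -- the factor `K ^ 6`.
    refine gaussianInt_eq_of_norm_mul_sub_lt
      (g := (K : ℂ) ^ 6 * ((E (1 - k)).1 * cross (H k) (H (1 - k)))) (G := K ^ 4)
      (e := K * (2 * K + 4) + K * 4) ?_ ?_ ?_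
    · rw [norm_mul, norm_pow, hnK, norm_mul]
      have := mul_le_mul (h.est_fst_ge (1 - k)) (h.norm_cross_ge k) zero_le_one (by positivity)
      nlinarith [mul_le_mul_of_nonneg_left this (by positivity : 0 ≤ K ^ 4)]
    · calc _ = ‖(H (1 - k)).1 * ((K : ℂ) ^ 6 * (z k 0 * cross (H k) (E (1 - k)) + z k 1 * (H k).1)
            - (K : ℂ) ^ 6 * (z' k 0 * cross (H k) (E (1 - k)) + z' k 1 * (H k).1))
            - (H k).1 * ((K : ℂ) ^ 6 * (z k 0 * cross (H (1 - k)) (E (1 - k))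
              + z k 1 * (H (1 - k)).1)
            - (K : ℂ) ^ 6 * (z' k 0 * cross (H (1 - k)) (E (1 - k))
              + z' k 1 * (H (1 - k)).1))‖ := by
            congr 1; simp only [cross]; ring
        _ ≤ _ := by
            refine (norm_sub_le _ _).trans (add_le_add ?_ ?_)
            · rw [norm_mul]
              exact mul_le_mul (h.fst_le _) h1 (norm_nonneg _) hK0.le
            · rw [norm_mul]
              exact mul_le_mul (h.fst_le _) h2 (norm_nonneg _) hK0.le
    · have : K ^ 3 ≤ K ^ 4 := pow_le_pow_right₀ (by linarith) (by norm_num)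
      nlinarith [mul_le_mul_of_nonneg_left hK (sq_nonneg K)]
  refine ⟨h0, ?_⟩
  rw [h0] at h1
  refine gaussianInt_eq_of_norm_mul_sub_lt (g := (K : ℂ) ^ 6 * (H k).1) (G := K ^ 5)
    (e := 2 * K + 4) ?_ ?_ ?_
  · rw [norm_mul, norm_pow, hnK]
    nlinarith [mul_le_mul_of_nonneg_left (h.fst_ge k) (by positivity : 0 ≤ K ^ 5)]
  · refine le_of_eq_of_le ?_ h1
    congr 1; ring
  · have : K ^ 2 ≤ K ^ 5 := pow_le_pow_right₀ (by linarith) (by norm_num)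
    nlinarith

/-! ### Transmit power, and the size of the interference. -/

lemma norm_smul_zeroForcing_le {q : ℂ × ℂ} (h1 : ‖q.1‖ ≤ K) (h2 : ‖q.2‖ ≤ K) (c : ℂ) :
    ‖c • zeroForcing q‖ ≤ ‖c‖ * K := by
  rw [norm_smul]
  gcongr
  simpa [zeroForcing, Prod.norm_def] using ⟨h2, h1⟩

/-- The effective input of the first slot is well below the power constraint. -/
lemma WellConditioned.norm_mixInput_le (h : WellConditioned K X H E) (hK : 8 ≤ K) (hX : 1 ≤ X)
    (hY : 0 ≤ Y) {z : Fin 2 → Fin 4 → GaussianInt} (hz : SymbolBound K X Y z) :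
    ‖mixInput K E z‖ ≤ X * Y / K := by
  have hK0 : 0 < K := by linarith
  have hnK : ‖(K : ℂ)‖ = K := by rw [Complex.norm_real, Real.norm_of_nonneg hK0.le]
  have hs : ∀ l, ‖stream K E z l‖ ≤ X * Y / (2 * K) := by
    intro l
    rw [stream, norm_smul, norm_pow, hnK]
    calc _ ≤ K ^ 6 * (2 * (X * Y) / K ^ 16 * K + 2 * Y / K ^ 16) := by
          gcongr
          refine (norm_add_le _ _).trans (add_le_add ?_ ?_)
          · refine (norm_smul_zeroForcing_le (h.est_fst_le _) (h.est_snd_le _) _).trans ?_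
            gcongr
            exact hz.forced l
          · rw [norm_smul]
            simpa [Prod.norm_def] using hz.free l
      _ ≤ K ^ 6 * (2 * (X * Y) / K ^ 16 * K + 2 * (X * Y) / K ^ 16 * K) := by
          gcongr
          have : 2 * Y ≤ 2 * (X * Y) := by nlinarith
          calc 2 * Y / K ^ 16 ≤ 2 * (X * Y) / K ^ 16 := by gcongr
            _ ≤ _ := le_mul_of_one_le_right (by positivity) (by linarith)
      _ = (8 / K ^ 8) * (X * Y / (2 * K)) := by field_simp; ring
      _ ≤ 1 * (X * Y / (2 * K)) := by
          gcongr
          rw [div_le_one (by positivity)]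
          exact hK.trans (le_self_pow₀ (by linarith) (by norm_num))
      _ = _ := one_mul _
  calc ‖mixInput K E z‖ ≤ ∑ l, ‖stream K E z l‖ := norm_sum_le _ _
    _ ≤ ∑ _l : Fin 2, X * Y / (2 * K) := Finset.sum_le_sum fun l _ => hs l
    _ = X * Y / K := by simp; field_simp

/-- Leakage of order `1 / X` brings the strong symbol, of order `X * Y`, down to the order `Y` of
the unprotected one. This is what lets the quantized interference fit into the common layer of a
later slot. The rounding error 2 is absorbed through `K ^ 8 ≤ Y`. -/
lemma WellConditioned.norm_overheard_le (h : WellConditioned K X H E) (hK : 8 ≤ K) (hX : 1 ≤ X)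
    (hY : K ^ 8 ≤ Y) {z : Fin 2 → Fin 4 → GaussianInt} (hz : SymbolBound K X Y z) (k : Fin 2) :
    ‖(overheard K H E z k : ℂ)‖ ≤ 6 * Y / K ^ 8 := by
  have hK0 : 0 < K := by linarith
  have hX0 : 0 < X := by linarith
  have hnK : ‖(K : ℂ)‖ = K := by rw [Complex.norm_real, Real.norm_of_nonneg hK0.le]
  have hY0 : 0 < Y := lt_of_lt_of_le (by positivity) hY
  have hp : ‖pairing (H k) (stream K E z (1 - k))‖ ≤ 4 * Y / K ^ 8 := by
    rw [pairing_stream, one_sub_one_sub, norm_mul, norm_pow, hnK]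
    calc _ ≤ K ^ 6 * (2 * (X * Y) / K ^ 16 * (K ^ 2 / X) + 2 * Y / K ^ 16 * K ^ 2) := by
          gcongr
          refine (norm_add_le _ _).trans (add_le_add ?_ ?_)
          · rw [norm_mul]
            gcongr
            · exact hz.forced _
            · rw [le_div_iff₀' hX0]; exact h.leak_le k
          · rw [norm_mul]
            gcongr
            · exact hz.free _
            · exact (h.fst_le k).trans (le_self_pow₀ (by linarith) (by norm_num))
      _ = 4 * Y / K ^ 8 := by field_simp; ring
  have hf := norm_sub_gaussFloor_le (pairing (H k) (stream K E z (1 - k)))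
  have h2 : 2 ≤ 2 * Y / K ^ 8 := by rw [le_div_iff₀ (by positivity)]; linarith
  calc ‖(overheard K H E z k : ℂ)‖
      = ‖pairing (H k) (stream K E z (1 - k)) - (pairing (H k) (stream K E z (1 - k))
        - overheard K H E z k)‖ := by congr 1; ring
    _ ≤ 4 * Y / K ^ 8 + 2 * Y / K ^ 8 := (norm_sub_le _ _).trans (add_le_add hp (hf.trans h2))
    _ = _ := by ring

/-- The effective input of a later slot is well below the power constraint. -/
lemma WellConditioned.norm_layeredInput_le (h : WellConditioned K X H E) (hK : 8 ≤ K)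
    (hX : 1 ≤ X) (hY : K ^ 8 ≤ Y) {c : GaussianInt} (hc : ‖(c : ℂ)‖ ≤ 6 * Y / K ^ 8)
    {p : Fin 2 → GaussianInt} (hp : ∀ l, ‖(p l : ℂ)‖ ≤ 2 * X / K ^ 16) :
    ‖layeredInput K X E c p‖ ≤ X * Y / K := by
  have hK0 : 0 < K := by linarith
  have hX0 : 0 < X := by linarith
  have hnK : ‖(K : ℂ)‖ = K := by rw [Complex.norm_real, Real.norm_of_nonneg hK0.le]
  have hnX : ‖(X : ℂ)‖ = X := by rw [Complex.norm_real, Real.norm_of_nonneg hX0.le]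
  have hY0 : 0 < Y := lt_of_lt_of_le (by positivity) hY
  have hY1 : 1 ≤ Y := (one_le_pow₀ (by linarith)).trans hY
  calc ‖layeredInput K X E c p‖
      ≤ K ^ 3 * X * (6 * Y / K ^ 8) + ∑ _l : Fin 2, K ^ 6 * (2 * X / K ^ 16) * K := by
        refine (norm_add_le _ _).trans (add_le_add ?_ ((norm_sum_le _ _).trans
          (Finset.sum_le_sum fun l _ => ?_)))
        · rw [norm_smul]
          have : ‖((1, 0) : ℂ × ℂ)‖ = 1 := by simp [Prod.norm_def]
          rw [this, mul_one, norm_mul, norm_mul, norm_pow, hnK, hnX]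
          gcongr
        · refine (norm_smul_zeroForcing_le (h.est_fst_le _) (h.est_snd_le _) _).trans ?_
          rw [norm_mul, norm_pow, hnK]
          gcongr
          exact hp l
    _ = 6 / K ^ 4 * (X * Y / K) + 4 * X / K ^ 9 := by simp; field_simp; ring
    _ ≤ 6 / K ^ 4 * (X * Y / K) + 4 / K ^ 8 * (X * Y / K) := by
        have : 4 * X / K ^ 9 ≤ 4 * (X * Y) / K ^ 9 := by gcongr; nlinarith
        refine add_le_add le_rfl (this.trans_eq ?_)
        field_simp
    _ ≤ 1 / 2 * (X * Y / K) + 1 / 2 * (X * Y / K) := by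
        have h4 : K ^ 2 ≤ K ^ 4 := pow_le_pow_right₀ (by linarith) (by norm_num)
        have h8 : K ^ 2 ≤ K ^ 8 := pow_le_pow_right₀ (by linarith) (by norm_num)
        have h6 : 6 / K ^ 4 ≤ 1 / 2 := by rw [div_le_iff₀ (by positivity)]; nlinarith
        have h4' : 4 / K ^ 8 ≤ 1 / 2 := by rw [div_le_iff₀ (by positivity)]; nlinarith
        exact add_le_add (mul_le_mul_of_nonneg_right h6 (by positivity))
          (mul_le_mul_of_nonneg_right h4' (by positivity))
    _ = X * Y / K := by ring

/-! ### Decoding by joint consistency -/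

/-- A measurable map to a finite type which picks `i` wherever `i` is the only index whose
measurable set is hit. -/
lemma exists_measurable_selection {Θ ι : Type*} [MeasurableSpace Θ] [Finite ι] [Nonempty ι]
    [MeasurableSpace ι] (A : ι → Set Θ) (hA : ∀ i, MeasurableSet (A i)) :
    ∃ f : Θ → ι, Measurable f ∧ ∀ θ i, θ ∈ A i → (∀ j, θ ∈ A j → j = i) → f θ = i := by
  classical
  -- The selection factors through the pattern of hit sets. There are finitely many patterns, so an
  -- arbitrary choice function on them is measurable.
  let g : (ι → Prop) → ι := fun T => if h : ∃ i, T i then h.choose else Classical.arbitrary ι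
  refine ⟨fun θ => g fun i => θ ∈ A i, ?_, fun θ i hi hu => ?_⟩
  · exact (measurable_of_finite g).comp
      (measurable_pi_iff.2 fun i => measurableSet_setOfPred.1 (hA i))
  · have h : ∃ j, θ ∈ A j := ⟨i, hi⟩
    simp only [g, dif_pos h]
    exact hu _ h.choose_spec

/-- Every measurable encoder can be completed to a code whose receivers are right as soon as the
noise is at most `N` and the noiseless outputs of messages that differ for this receiver are more
than `2 * N` apart. -/
lemma exists_code_of_encoder {m L M : ℕ} [NeZero M]
    (enc : (t : Fin L) → (Fin 2 → Fin M) → (Fin (t : ℕ) → State m) →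
      (Fin ((t : ℕ) + 1) → State m) → (Fin m → ℂ))
    (henc : ∀ (t : Fin L) (w : Fin 2 → Fin M), Measurable
      (fun p : (Fin (t : ℕ) → State m) × (Fin ((t : ℕ) + 1) → State m) => enc t w p.1 p.2))
    (N : ℝ) :
    ∃ c : Code m L M, c.enc = enc ∧ ∀ w s shat n k, (∀ t, ‖n k t‖ ≤ N) →
      (∀ v, (∀ t : Fin L, ‖(∑ i, s t k i * c.input w s shat t i)
        - ∑ i, s t k i * c.input v s shat t i‖ ≤ 2 * N) → v k = w k) →
      c.decoded w s shat n k = w k := by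
  let x : ((Fin L → ℂ) × (Fin L → State m) × (Fin L → State m)) → (Fin 2 → Fin M) → Fin L →
      Fin m → ℂ := fun θ v t => enc t v (fun τ => θ.2.1 ⟨τ, τ.2.trans t.2⟩)
        (fun τ => θ.2.2 ⟨τ, lt_of_lt_of_le τ.2 t.2⟩)
  have hx : ∀ v t, Measurable fun θ => x θ v t := fun v t =>
    (henc t v).comp (f := fun θ : (Fin L → ℂ) × (Fin L → State m) × (Fin L → State m) =>
      ((fun τ : Fin (t : ℕ) => θ.2.1 ⟨τ, τ.2.trans t.2⟩),
        (fun τ : Fin ((t : ℕ) + 1) => θ.2.2 ⟨τ, lt_of_lt_of_le τ.2 t.2⟩))) (by fun_prop)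
  -- `A k u` collects the observations explained, up to noise `N`, by some message pair with `k`-th
  -- entry `u`. The other user's message is left free, so it need not be decodable.
  let A : Fin 2 → Fin M → Set ((Fin L → ℂ) × (Fin L → State m) × (Fin L → State m)) :=
    fun k u => ⋃ v ∈ {v : Fin 2 → Fin M | v k = u}, ⋂ t,
      {θ | ‖θ.1 t - ∑ i, θ.2.1 t k i * x θ v t i‖ ≤ N}
  have hA : ∀ k u, MeasurableSet (A k u) := by
    intro k u
    refine MeasurableSet.biUnion (Set.to_countable _) fun v _ => MeasurableSet.iInter fun t => ?_
    have := hx v t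
    exact measurableSet_le (by fun_prop) measurable_const
  choose dec hdec hsel using fun k => exists_measurable_selection (A k) (hA k)
  refine ⟨⟨enc, fun k y s shat => dec k (y, s, shat), henc, hdec⟩, rfl, ?_⟩
  intro w s shat n k hn hsep
  refine hsel k _ _ ?_ ?_
  · refine Set.mem_biUnion (x := w) rfl (Set.mem_iInter.2 fun t => ?_)
    simpa [Code.output, Code.input, x] using hn t
  · intro u hu
    obtain ⟨v, rfl, hv⟩ := Set.mem_iUnion₂.1 hu
    refine hsep v fun t => ?_
    have h1 : ‖((∑ i, s t k i * enc t w (fun τ => s τ) (fun τ => shat τ) i) + n k t)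
        - ∑ i, s t k i * enc t v (fun τ => s τ) (fun τ => shat τ) i‖ ≤ N :=
      Set.mem_iInter.1 hv t
    calc _ = ‖(((∑ i, s t k i * enc t w (fun τ => s τ) (fun τ => shat τ) i) + n k t)
        - ∑ i, s t k i * enc t v (fun τ => s τ) (fun τ => shat τ) i) - n k t‖ := by
          congr 1
          simp only [Code.input]
          ring
      _ ≤ N + N := (norm_sub_le _ _).trans (add_le_add h1 (hn t))
      _ = 2 * N := by ring

instance : IsProbabilityMeasure stdComplexGaussian := by
  refine Measure.isProbabilityMeasure_map (Measurable.aemeasurable ?_)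
  exact Complex.measurableEquivRealProd.symm.measurable

instance (L : ℕ) : IsProbabilityMeasure (noiseLaw L) := by
  unfold noiseLaw; infer_instance

/-- The error probability is at most the probability of a channel outage plus the probability of
a large noise sample. -/
lemma Code.errorProb_le {m L M : ℕ} [NeZero M] (c : Code m L M) {Ω : Type*} [MeasurableSpace Ω]
    (μ : Measure Ω) [IsProbabilityMeasure μ] (S Shat : ℕ → Ω → State m) (B : Set Ω) (N : ℝ)
    (h : ∀ ω ∉ B, ∀ w n k, (∀ t, ‖n k t‖ ≤ N) →
      c.decoded w (fun τ => S τ ω) (fun τ => Shat τ ω) n k = w k) :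
    c.errorProb μ S Shat ≤ μ B + noiseLaw L {n | ∃ k t, N < ‖n k t‖} := by
  set G := {n : Fin 2 → Fin L → ℂ | ∃ k t, N < ‖n k t‖}
  have hw : ∀ w : Fin 2 → Fin M, (μ.prod (noiseLaw L))
      {p | ∃ k, c.decoded w (fun τ => S τ p.1) (fun τ => Shat τ p.1) p.2 k ≠ w k}
        ≤ μ B + noiseLaw L G := by
    intro w
    refine (measure_mono (t := B ×ˢ Set.univ ∪ Set.univ ×ˢ G) ?_).trans
      ((measure_union_le _ _).trans ?_)
    · rintro ⟨ω, n⟩ ⟨k, hk⟩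
      by_contra hc
      simp only [Set.mem_union, Set.mem_prod, Set.mem_univ, and_true, true_and, not_or] at hc
      refine hk (h ω hc.1 w n k fun t => ?_)
      by_contra! hN
      exact hc.2 ⟨k, t, hN⟩
    · simp [Measure.prod_prod]
  unfold Code.errorProb
  refine ENNReal.div_le_of_le_mul ?_
  refine (Finset.sum_le_sum fun w _ => hw w).trans_eq ?_
  simp [mul_add, mul_comm]

/-! ### The encoder -/

/-- The effective two-antenna channels seen through the beams `a` and `b`. -/
def effective {m : ℕ} (a b : Fin m → ℂ) (s : State m) (k : Fin 2) : ℂ × ℂ :=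
  (∑ i, s k i * a i, ∑ i, s k i * b i)

/-- The input that sends an effective input on the beams `a` and `b`. -/
def combine {m : ℕ} (a b : Fin m → ℂ) (p : ℂ × ℂ) : Fin m → ℂ := fun i => p.1 * a i + p.2 * b i

/-- Silence instead of an input of power above `P`. -/
def clip {m : ℕ} (P : ℝ) (x : Fin m → ℂ) : Fin m → ℂ :=
  if ∑ i, ‖x i‖ ^ 2 ≤ P then x else 0

/-- A finite history, continued by zeros. -/
def extendHistory {m n : ℕ} (f : Fin n → State m) : ℕ → State m :=
  fun τ => if h : τ < n then f ⟨τ, h⟩ else 0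

/-- The effective input of the three slots, for the beams `a`, `b` and the map `est` from channel
estimates to estimates of the effective channels. -/
def schemeInput {m : ℕ} (K X : ℝ) (a b : Fin m → ℂ) (est : State m → Fin 2 → ℂ × ℂ)
    (z : Fin 2 → Fin 4 → GaussianInt) (s shat : ℕ → State m) (t : Fin 3) : ℂ × ℂ :=
  Fin.cases (mixInput K (est (shat 0)) z)
    (fun j : Fin 2 => layeredInput K X (est (shat (j.succ : Fin 3)))
      (overheard K (effective a b (s 0)) (est (shat 0)) z j) (fun l => z l j.succ.succ)) t

lemma extendHistory_restrict {m n : ℕ} (s : ℕ → State m) {τ : ℕ} (h : τ < n) :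
    extendHistory (fun σ : Fin n => s σ) τ = s τ := by
  simp [extendHistory, h]

/-- Causality of the scheme: slot `t` reads the estimates at times `0` and `t` only, and the state
at time `0` only when `t` is positive. -/
lemma schemeInput_extendHistory {m : ℕ} (K X : ℝ) (a b : Fin m → ℂ)
    (est : State m → Fin 2 → ℂ × ℂ) (z : Fin 2 → Fin 4 → GaussianInt) (s shat : ℕ → State m)
    (t : Fin 3) :
    schemeInput K X a b est z (extendHistory fun σ : Fin (t : ℕ) => s σ)
      (extendHistory fun σ : Fin ((t : ℕ) + 1) => shat σ) t = schemeInput K X a b est z s shat t := by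
  induction t using Fin.cases with
  | zero => simp only [schemeInput, Fin.cases_zero]; rw [extendHistory_restrict _ (by simp)]
  | succ j =>
    simp only [schemeInput, Fin.cases_succ]
    rw [extendHistory_restrict _ (by simp), extendHistory_restrict _ (by simp),
      extendHistory_restrict _ (by simp)]

lemma sum_mul_combine {m : ℕ} (a b : Fin m → ℂ) (s : State m) (k : Fin 2) (p : ℂ × ℂ) :
    ∑ i, s k i * combine a b p i = pairing (effective a b s k) p := by
  simp only [combine, pairing, effective, Finset.sum_mul, ← Finset.sum_add_distrib]
  exact Finset.sum_congr rfl fun i _ => by ring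

lemma sum_norm_sq_clip_le {m : ℕ} {P : ℝ} (hP : 0 ≤ P) (x : Fin m → ℂ) :
    ∑ i, ‖clip P x i‖ ^ 2 ≤ P := by
  unfold clip
  split_ifs with h
  · exact h
  · simpa using hP

/-- Clipping secures the power constraint on every channel realization. This shows that it is
inactive for the well-conditioned ones, so decoding may ignore it. -/
lemma clip_combine {m : ℕ} {a b : Fin m → ℂ} {P K R : ℝ} {p : ℂ × ℂ} (hK : 0 < K)
    (hab : ∑ i, (‖a i‖ + ‖b i‖) ^ 2 ≤ K ^ 2) (hp : ‖p‖ ≤ R / K) (hR : R ^ 2 ≤ P) :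
    clip P (combine a b p) = combine a b p := by
  refine if_pos ?_
  calc ∑ i, ‖combine a b p i‖ ^ 2 ≤ ∑ i, ‖p‖ ^ 2 * (‖a i‖ + ‖b i‖) ^ 2 := by
        refine Finset.sum_le_sum fun i _ => ?_
        rw [← mul_pow, mul_add]
        gcongr
        refine (norm_add_le _ _).trans (add_le_add ?_ ?_)
        · rw [norm_mul]; gcongr; exact norm_fst_le p
        · rw [norm_mul]; gcongr; exact norm_snd_le p
    _ = ‖p‖ ^ 2 * ∑ i, (‖a i‖ + ‖b i‖) ^ 2 := by rw [Finset.mul_sum]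
    _ ≤ (R / K) ^ 2 * K ^ 2 := by gcongr
    _ = R ^ 2 := by field_simp
    _ ≤ P := hR

/-! ### Measurability -/

lemma measurable_clip {m : ℕ} (P : ℝ) : Measurable (clip P : (Fin m → ℂ) → Fin m → ℂ) :=
  Measurable.ite (measurableSet_le (by fun_prop) measurable_const) measurable_id measurable_const

lemma measurable_combine {m : ℕ} (a b : Fin m → ℂ) : Measurable (combine a b) := by
  unfold combine; fun_prop

lemma measurable_effective {m : ℕ} (a b : Fin m → ℂ) : Measurable (effective a b) := by
  unfold effective; fun_prop

lemma measurable_extendHistory {m n : ℕ} (τ : ℕ) :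
    Measurable fun f : Fin n → State m => extendHistory f τ := by
  unfold extendHistory; split_ifs <;> fun_prop

lemma measurable_gaussFloor : Measurable fun z : ℂ => (gaussFloor z : ℂ) := by
  simp only [gaussFloor, GaussianInt.toComplex_def]
  have h1 : Measurable fun z : ℂ => ((⌊z.re⌋ : ℤ) : ℂ) :=
    (measurable_of_countable (fun n : ℤ => (n : ℂ))).comp Complex.measurable_re.floor
  have h2 : Measurable fun z : ℂ => ((⌊z.im⌋ : ℤ) : ℂ) :=
    (measurable_of_countable (fun n : ℤ => (n : ℂ))).comp Complex.measurable_im.floor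
  fun_prop

lemma measurable_zeroForcing : Measurable zeroForcing := by
  unfold zeroForcing; fun_prop

section
variable {Θ : Type*} [MeasurableSpace Θ] {E H : Θ → Fin 2 → ℂ × ℂ}

lemma measurable_stream (K : ℝ) (z : Fin 2 → Fin 4 → GaussianInt) (l : Fin 2)
    (hE : Measurable E) : Measurable fun θ => stream K (E θ) z l := by
  have h1 : Measurable fun θ => zeroForcing (E θ (1 - l)) :=
    measurable_zeroForcing.comp (measurable_pi_iff.1 hE _)
  unfold stream; fun_prop

lemma measurable_mixInput (K : ℝ) (z : Fin 2 → Fin 4 → GaussianInt) (hE : Measurable E) :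
    Measurable fun θ => mixInput K (E θ) z :=
  Finset.measurable_fun_sum _ fun l _ => measurable_stream K z l hE

lemma measurable_overheard (K : ℝ) (z : Fin 2 → Fin 4 → GaussianInt) (k : Fin 2)
    (hH : Measurable H) (hE : Measurable E) :
    Measurable fun θ => (overheard K (H θ) (E θ) z k : ℂ) := by
  have h1 : Measurable fun θ => H θ k := measurable_pi_iff.1 hH k
  have h2 := measurable_stream K z (1 - k) hE
  refine measurable_gaussFloor.comp ?_
  unfold pairing; fun_prop

lemma measurable_layeredInput (K X : ℝ) (p : Fin 2 → GaussianInt) {c : Θ → GaussianInt}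
    (hc : Measurable fun θ => (c θ : ℂ)) (hE : Measurable E) :
    Measurable fun θ => layeredInput K X (E θ) (c θ) p := by
  have h1 : ∀ l, Measurable fun θ => zeroForcing (E θ (1 - l)) := fun l =>
    measurable_zeroForcing.comp (measurable_pi_iff.1 hE _)
  unfold layeredInput; fun_prop

lemma measurable_schemeInput {m : ℕ} (K X : ℝ) (a b : Fin m → ℂ) {est : State m → Fin 2 → ℂ × ℂ}
    (hest : Measurable est) (z : Fin 2 → Fin 4 → GaussianInt) {s shat : Θ → ℕ → State m}
    (hs : ∀ τ, Measurable fun θ => s θ τ) (hshat : ∀ τ, Measurable fun θ => shat θ τ) (t : Fin 3) :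
    Measurable fun θ => schemeInput K X a b est z (s θ) (shat θ) t := by
  induction t using Fin.cases with
  | zero => exact measurable_mixInput K z (hest.comp (hshat 0))
  | succ j =>
    exact measurable_layeredInput K X _ (measurable_overheard K z j
      ((measurable_effective a b).comp (hs 0)) (hest.comp (hshat 0))) (hest.comp (hshat _))

end

/-! ### The code -/

/-- The clipped encoder of the three-slot scheme. -/
def schemeEnc {m M : ℕ} (P K X : ℝ) (a b : Fin m → ℂ) (est : State m → Fin 2 → ℂ × ℂ)
    (sym : Fin M → Fin 4 → GaussianInt) (t : Fin 3) (w : Fin 2 → Fin M)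
    (f : Fin (t : ℕ) → State m) (g : Fin ((t : ℕ) + 1) → State m) : Fin m → ℂ :=
  clip P (combine a b
    (schemeInput K X a b est (fun l => sym (w l)) (extendHistory f) (extendHistory g) t))

lemma measurable_schemeEnc {m M : ℕ} (P K X : ℝ) (a b : Fin m → ℂ)
    {est : State m → Fin 2 → ℂ × ℂ} (hest : Measurable est) (sym : Fin M → Fin 4 → GaussianInt)
    (t : Fin 3) (w : Fin 2 → Fin M) : Measurable
      (fun p : (Fin (t : ℕ) → State m) × (Fin ((t : ℕ) + 1) → State m) =>
        schemeEnc P K X a b est sym t w p.1 p.2) :=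
  (measurable_clip P).comp ((measurable_combine a b).comp
    (measurable_schemeInput K X a b hest _
      (fun τ => (measurable_extendHistory τ).comp measurable_fst)
      (fun τ => (measurable_extendHistory τ).comp measurable_snd) t))

/-- The three-slot code meets the power constraint, and its receivers are right whenever the
effective channels are well conditioned and the noise is at most `K`. -/
lemma exists_scheme_code {m M : ℕ} [NeZero M] {P K X Y : ℝ} (a b : Fin m → ℂ)
    {est : State m → Fin 2 → ℂ × ℂ} (hest : Measurable est) {sym : Fin M → Fin 4 → GaussianInt}
    (hsym : Function.Injective sym) :
    ∃ c : Code m 3 M,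
      (0 ≤ P → ∀ {Ω : Type*} [MeasurableSpace Ω] (μ : Measure Ω) [IsProbabilityMeasure μ]
        (S Shat : ℕ → Ω → State m) (t), c.avgPower μ S Shat t ≤ ENNReal.ofReal P) ∧
      (8 ≤ K → 1 ≤ X → K ^ 8 ≤ Y → (X * Y) ^ 2 ≤ P → ∑ i, (‖a i‖ + ‖b i‖) ^ 2 ≤ K ^ 2 →
        (∀ w : Fin 2 → Fin M, SymbolBound K X Y fun l => sym (w l)) →
        ∀ s shat, (∀ t : Fin 3, WellConditioned K X (effective a b (s t)) (est (shat t))) →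
          ∀ w n k, (∀ t, ‖n k t‖ ≤ K) → c.decoded w s shat n k = w k) := by
  obtain ⟨c, hc, hdec⟩ := exists_code_of_encoder (schemeEnc P K X a b est sym)
    (measurable_schemeEnc P K X a b hest sym) K
  have hin : ∀ w s shat t, c.input w s shat t =
      clip P (combine a b (schemeInput K X a b est (fun l => sym (w l)) s shat t)) := by
    intro w s shat t
    rw [Code.input, hc, schemeEnc, schemeInput_extendHistory]
  refine ⟨c, ?_, ?_⟩
  · intro hP Ω _ μ _ S Shat t
    unfold Code.avgPower
    refine ENNReal.div_le_of_le_mul ?_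
    calc _ ≤ ∑ _w : Fin 2 → Fin M, ENNReal.ofReal P := by
          refine Finset.sum_le_sum fun w _ => ?_
          calc _ ≤ ∫⁻ _, ENNReal.ofReal P ∂μ := by
                refine lintegral_mono fun ω => ?_
                rw [hin]
                refine le_trans (le_of_eq ?_) (ENNReal.ofReal_le_ofReal (sum_norm_sq_clip_le hP
                  (combine a b (schemeInput K X a b est (fun l => sym (w l))
                    (fun τ => S τ ω) (fun τ => Shat τ ω) t))))
                rw [ENNReal.ofReal_sum_of_nonneg fun i _ => by positivity]
                refine Finset.sum_congr rfl fun i _ => ?_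
                rw [ENNReal.ofReal_pow (norm_nonneg _), ofReal_norm]
            _ = ENNReal.ofReal P := by simp
      _ = _ := by simp [mul_comm]
  · intro hK hX hY hXY hab hbd s shat hwc w n k hn
    have hK0 : 0 < K := by linarith
    have hY0 : 0 ≤ Y := le_trans (by positivity) hY
    have hclip : ∀ w t, c.input w s shat t =
        combine a b (schemeInput K X a b est (fun l => sym (w l)) s shat t) := by
      intro w t
      rw [hin]
      refine clip_combine hK0 hab (R := X * Y) ?_ hXY
      induction t using Fin.cases with
      | zero => exact (hwc 0).norm_mixInput_le hK hX hY0 (hbd w)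
      | succ j =>
        exact (hwc j.succ).norm_layeredInput_le hK hX hY
          ((hwc 0).norm_overheard_le hK hX hY (hbd w) j) fun l => (hbd w).layered l j
    refine hdec w s shat n k hn fun v hv => ?_
    simp only [hclip, sum_mul_combine] at hv
    -- The later slots come first: their common symbols are the quantized interferences that
    -- resolving the first slot requires.
    have hlay : ∀ j : Fin 2, _ := fun j => (hwc j.succ).layered_separation hK hX
      (fun l => (hbd w).layered l j) (fun l => (hbd v).layered l j) k (hv j.succ)
    have hmix := (hwc 0).mix_separation hK k (fun l => (hlay l).1) (hv 0)
    refine hsym (funext fun i => ?_)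
    symm
    fin_cases i
    · exact hmix.1
    · exact hmix.2
    · exact (hlay 0).2
    · exact (hlay 1).2

/-! ### Events of vanishing probability -/

/-- The property `p P` holds with probability tending to one as `P → ∞`. -/
def WithHighProb {Ω : Type*} [MeasurableSpace Ω] (μ : Measure Ω) (p : ℝ → Ω → Prop) : Prop :=
  Tendsto (fun P => μ {ω | ¬ p P ω}) atTop (𝓝 0)

section
variable {Ω : Type*} [MeasurableSpace Ω] {μ : Measure Ω} {p q : ℝ → Ω → Prop}

lemma WithHighProb.mono (hp : WithHighProb μ p) (h : ∀ᶠ P in atTop, ∀ ω, p P ω → q P ω) :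
    WithHighProb μ q := by
  refine tendsto_of_tendsto_of_tendsto_of_le_of_le' tendsto_const_nhds hp
    (Eventually.of_forall fun _ => zero_le) ?_
  filter_upwards [h] with P hP
  exact measure_mono fun ω hω hpω => hω (hP ω hpω)

lemma WithHighProb.and (hp : WithHighProb μ p) (hq : WithHighProb μ q) :
    WithHighProb μ fun P ω => p P ω ∧ q P ω := by
  have h := hp.add hq
  rw [add_zero] at h
  refine tendsto_of_tendsto_of_tendsto_of_le_of_le tendsto_const_nhds h (fun _ => zero_le) ?_
  intro P
  refine (measure_mono ?_).trans (measure_union_le _ _)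
  intro ω hω
  by_contra hc
  simp only [Set.mem_union, Set.mem_ofPred_eq, not_or, not_not] at hc
  exact hω hc

lemma WithHighProb.forall {ι : Type*} [Finite ι] {p : ι → ℝ → Ω → Prop}
    (hp : ∀ i, WithHighProb μ (p i)) : WithHighProb μ fun P ω => ∀ i, p i P ω := by
  have := Fintype.ofFinite ι
  have h : Tendsto (fun P => ∑ i, μ {ω | ¬ p i P ω}) atTop (𝓝 0) := by
    simpa using tendsto_finsetSum Finset.univ fun i _ => hp i
  refine tendsto_of_tendsto_of_tendsto_of_le_of_le tendsto_const_nhds h (fun _ => zero_le) ?_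
  intro P
  refine (measure_mono ?_).trans (measure_iUnion_fintype_le μ fun i => {ω | ¬ p i P ω})
  intro ω hω
  simpa using hω

/-- Continuity from above: the sets where `f` exceeds a level decrease to the empty set. No moment
is needed, since `f` does not vary with `P`. -/
lemma withHighProb_le [IsFiniteMeasure μ] {f : Ω → ℝ} (hf : Measurable f) {K : ℝ → ℝ}
    (hK : Tendsto K atTop atTop) : WithHighProb μ fun P ω => f ω ≤ K P := by
  have h : Tendsto (fun x : ℝ => μ {ω | ¬ f ω ≤ x}) atTop (𝓝 0) := by
    have hanti : Antitone fun x : ℝ => {ω | ¬ f ω ≤ x} :=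
      fun x y hxy ω hω hx => hω (hx.trans hxy)
    have := tendsto_measure_iInter_atTop (μ := μ) (s := fun x : ℝ => {ω | ¬ f ω ≤ x})
      (fun x => (measurableSet_le hf measurable_const).compl.nullMeasurableSet) hanti
      ⟨0, measure_ne_top _ _⟩
    have hempty : ⋂ x : ℝ, {ω | ¬ f ω ≤ x} = ∅ := by
      ext ω
      simp only [Set.mem_iInter, Set.mem_ofPred_eq, Set.mem_empty_iff_false, iff_false, not_forall,
        not_not]
      exact ⟨f ω, le_rfl⟩
    rwa [hempty, measure_empty] at this
  exact h.comp hK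

/-- The upper bound applied to `‖f‖⁻¹`. The convention `0⁻¹ = 0` would spoil it at zeros of `f`,
which form a null set. -/
lemma withHighProb_ge [IsFiniteMeasure μ] {f : Ω → ℂ} (hf : Measurable f)
    (hf0 : ∀ᵐ ω ∂μ, f ω ≠ 0) {K : ℝ → ℝ} (hK : Tendsto K atTop atTop) :
    WithHighProb μ fun P ω => 1 ≤ K P * ‖f ω‖ := by
  have h := withHighProb_le (μ := μ) (f := fun ω => ‖f ω‖⁻¹) (by fun_prop) hK
  refine tendsto_of_tendsto_of_tendsto_of_le_of_le tendsto_const_nhds h (fun _ => zero_le) ?_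
  intro P
  refine measure_mono_ae ?_
  filter_upwards [hf0] with ω h0 hω hc
  refine hω ?_
  rwa [inv_le_iff_one_le_mul₀ (norm_pos_iff.2 h0)] at hc

/-- A square-integrable estimation error is small, at the scale of its standard deviation. -/
lemma measure_norm_gt_le {f : Ω → ℂ} {v : ℝ} (hf : MemLp f 2 μ)
    (hv : ∫ ω, f ω * star (f ω) ∂μ = v) {δ : ℝ} (hδ : 0 < δ) :
    μ {ω | ¬ ‖f ω‖ ≤ δ} ≤ ENNReal.ofReal (v / δ ^ 2) := by
  have hint : Integrable (fun ω => ‖f ω‖ ^ 2) μ := hf.integrable_norm_pow (by norm_num)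
  have hv' : ∫ ω, ‖f ω‖ ^ 2 ∂μ = v := by
    have h : ∀ ω, f ω * star (f ω) = ((‖f ω‖ ^ 2 : ℝ) : ℂ) := fun ω => by
      rw [Complex.star_def, Complex.mul_conj, Complex.normSq_eq_norm_sq]
    simp_rw [h] at hv
    rw [integral_complex_ofReal] at hv
    exact_mod_cast hv
  have hl : ∫⁻ ω, ENNReal.ofReal (‖f ω‖ ^ 2) ∂μ = ENNReal.ofReal v := by
    rw [← hv', ofReal_integral_eq_lintegral_ofReal hint (ae_of_all _ fun ω => by positivity)]
  rw [ENNReal.ofReal_div_of_pos (by positivity), ← hl]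
  refine (measure_mono ?_).trans (meas_ge_le_lintegral_div
    (hint.aestronglyMeasurable.aemeasurable.ennreal_ofReal) (by positivity) ENNReal.ofReal_ne_top)
  intro ω hω
  simp only [Set.mem_ofPred_eq, not_le] at hω ⊢
  gcongr

end

/-! ### Generic beams -/

/-- Almost every beam is seen by a channel that almost surely does not vanish. -/
lemma ae_ae_sum_mul_ne_zero {Ω : Type*} [MeasurableSpace Ω] {μ : Measure Ω} [SFinite μ] {m : ℕ}
    {v : Ω → Fin m → ℂ} (hv : Measurable v) (h0 : ∀ᵐ ω ∂μ, v ω ≠ 0) :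
    ∀ᵐ a : Fin m → ℂ, ∀ᵐ ω ∂μ, ∑ i, v ω i * a i ≠ 0 := by
  have hm : MeasurableSet {x : Ω × (Fin m → ℂ) | ∑ i, v x.1 i * x.2 i ≠ 0} :=
    (measurableSet_eq_fun (by fun_prop) measurable_const).compl
  have key : ∀ᵐ ω ∂μ, ∀ᵐ a ∂(volume : Measure (Fin m → ℂ)), ∑ i, v ω i * a i ≠ 0 := by
    filter_upwards [h0] with ω hω
    -- For a fixed nonzero channel the bad beams are the kernel of a nonzero linear map, a proper
    -- subspace and thus Lebesgue null. Fubini then exchanges the two quantifiers.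
    let φ : (Fin m → ℂ) →ₗ[ℝ] ℂ :=
      { toFun := fun a => ∑ i, v ω i * a i
        map_add' := fun a b => by simp [mul_add, Finset.sum_add_distrib]
        map_smul' := fun c a => by
          simp only [Pi.smul_apply, Complex.real_smul, RingHom.id_apply, Finset.mul_sum]
          exact Finset.sum_congr rfl fun i _ => by ring }
    have hφ : LinearMap.ker φ ≠ ⊤ := by
      intro htop
      apply hω
      ext j
      have : φ (Pi.single j 1) = 0 := by
        rw [← LinearMap.mem_ker, htop]; trivial
      simpa [φ, Pi.single_apply] using this
    have := Measure.addHaar_submodule volume (LinearMap.ker φ) hφ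
    rw [ae_iff]
    refine measure_mono_null (fun a ha => ?_) this
    simpa [φ] using ha
  exact (Measure.ae_ae_comm (p := fun ω (a : Fin m → ℂ) => ∑ i, v ω i * a i ≠ 0) hm).1 key

lemma linearIndependent_of_rank_eq_two {m : ℕ} {s : State m} (h : (Matrix.of s).rank = 2) :
    LinearIndependent ℂ ![s 0, s 1] := by
  have : LinearIndependent ℂ (Matrix.of s).row := by
    rw [linearIndependent_iff_card_eq_finrank_span, Set.finrank,
      ← Matrix.rank_eq_finrank_span_row, h]
    simp
  convert this using 1
  ext i j
  fin_cases i <;> rfl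

/-- There are two fixed beams through which the channels of both users and the determinant of the
effective channel almost surely do not vanish. -/
lemma IndependentFading.exists_beams {Ω : Type*} [MeasurableSpace Ω] {μ : Measure Ω}
    [IsProbabilityMeasure μ] {m : ℕ} {S : ℕ → Ω → State m} (hS : IndependentFading μ S) :
    ∃ a b : Fin m → ℂ, ∀ t, ∀ᵐ ω ∂μ, (∀ k, (effective a b (S t ω) k).1 ≠ 0) ∧
      (∀ k, (effective a b (S t ω) k).2 ≠ 0) ∧
      cross (effective a b (S t ω) 0) (effective a b (S t ω) 1) ≠ 0 := by
  have hli : ∀ t, ∀ᵐ ω ∂μ, LinearIndependent ℂ ![S t ω 0, S t ω 1] := fun t =>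
    (hS.rank t).mono fun ω h => linearIndependent_of_rank_eq_two h
  have hne : ∀ t k, ∀ᵐ ω ∂μ, S t ω k ≠ 0 := fun t k => (hli t).mono fun ω h => by
    have := h.ne_zero k
    fin_cases k <;> simpa using this
  have hm : ∀ t k, Measurable fun ω => S t ω k := fun t k => measurable_pi_iff.1 (hS.measurable t) k
  have hgen : ∀ᵐ a : Fin m → ℂ, ∀ t k, ∀ᵐ ω ∂μ, ∑ i, S t ω k i * a i ≠ 0 :=
    ae_all_iff.2 fun t => ae_all_iff.2 fun k => ae_ae_sum_mul_ne_zero (hm t k) (hne t k)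
  obtain ⟨a, ha⟩ := hgen.exists
  -- With `a` fixed, the effective determinant is linear in `b` with coefficient vector `v`. Linear
  -- independence of the two channels and nonvanishing of the first one through `a` give `v ≠ 0`, so
  -- a generic `b` works.
  let v : ℕ → Ω → Fin m → ℂ := fun t ω =>
    (∑ i, S t ω 0 i * a i) • S t ω 1 - (∑ i, S t ω 1 i * a i) • S t ω 0
  have hv : ∀ t, ∀ᵐ ω ∂μ, v t ω ≠ 0 := by
    intro t
    filter_upwards [hli t, ha t 0] with ω hω h0 hc
    rw [LinearIndependent.pair_iff] at hω
    have := hω (-(∑ i, S t ω 1 i * a i)) (∑ i, S t ω 0 i * a i) (by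
      rw [← hc]; simp only [v]; module)
    exact h0 this.2
  have hvm : ∀ t, Measurable (v t) := fun t => by
    have := hm t
    fun_prop
  have hgen' : ∀ᵐ b : Fin m → ℂ, ∀ t, ∀ᵐ ω ∂μ, ∑ i, v t ω i * b i ≠ 0 :=
    ae_all_iff.2 fun t => ae_ae_sum_mul_ne_zero (hvm t) (hv t)
  obtain ⟨b, hb, hb'⟩ := (hgen.and hgen').exists
  refine ⟨a, b, fun t => ?_⟩
  filter_upwards [ae_all_iff.2 (ha t), ae_all_iff.2 (hb t), hb' t] with ω h1 h2 h3
  refine ⟨h1, h2, fun hc => h3 ?_⟩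
  rw [← hc]
  simp only [v, cross, effective, Pi.sub_apply, Pi.smul_apply, smul_eq_mul, sub_mul,
    Finset.sum_sub_distrib, mul_assoc, ← Finset.mul_sum]
  ring

/-! ### The channel is well conditioned with high probability -/

lemma norm_cross_le {p q : ℂ × ℂ} {A B : ℝ} (hp1 : ‖p.1‖ ≤ A) (hp2 : ‖p.2‖ ≤ A) (hq1 : ‖q.1‖ ≤ B)
    (hq2 : ‖q.2‖ ≤ B) : ‖cross p q‖ ≤ 2 * (A * B) := by
  have hA : 0 ≤ A := (norm_nonneg _).trans hp1
  refine (norm_sub_le _ _).trans ?_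
  rw [norm_mul, norm_mul, two_mul]
  gcongr

/-- Accurate estimates of well-conditioned effective channels are well conditioned. -/
lemma wellConditioned_of_accurate {K X : ℝ} {H E : Fin 2 → ℂ × ℂ} (hK : 8 ≤ K)
    (hX : 2 * K ^ 2 ≤ X) (h1 : ∀ k, ‖(H k).1‖ ≤ K / 2) (h2 : ∀ k, ‖(H k).2‖ ≤ K / 2)
    (h1' : ∀ k, 1 ≤ K / 2 * ‖(H k).1‖) (hc : 1 ≤ K / 2 * ‖cross (H 0) (H 1)‖)
    (hE1 : ∀ k, ‖(H k - E k).1‖ ≤ 1 / X) (hE2 : ∀ k, ‖(H k - E k).2‖ ≤ 1 / X) :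
    WellConditioned K X H E := by
  have hK0 : 0 < K := by linarith
  have hX0 : 0 < X := lt_of_lt_of_le (by positivity) hX
  have hKX : K * (K * (1 / X)) ≤ 1 / 2 := by
    rw [← mul_assoc, mul_one_div, div_le_iff₀ hX0]; nlinarith
  have hX1 : 1 / X ≤ 1 := by rw [div_le_one hX0]; nlinarith
  have hX1' : 0 < 1 / X := by positivity
  have hdiff : ∀ k l, ‖cross (H k) (H l - E l)‖ ≤ K * (1 / X) := fun k l =>
    (norm_cross_le (h1 k) (h2 k) (hE1 l) (hE2 l)).trans_eq (by ring)
  have hcc : ∀ k, 1 ≤ K / 2 * ‖cross (H k) (H (1 - k))‖ := by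
    intro k
    fin_cases k
    · simpa using hc
    · simpa [norm_cross_comm (H 1)] using hc
  have hcr : ∀ k l, cross (H k) (E l) = cross (H k) (H l) - cross (H k) (H l - E l) := by
    intro k l; simp only [cross, Prod.fst_sub, Prod.snd_sub]; ring
  have hd1 : ∀ k, ‖(H k).1 - (E k).1‖ ≤ 1 / X := hE1
  have hd2 : ∀ k, ‖(H k).2 - (E k).2‖ ≤ 1 / X := hE2
  refine ⟨fun k => ?_, fun k => ?_, fun k => ?_, fun k => ?_, fun k => ?_, fun k => ?_, ?_,
    fun k => ?_, fun k => ?_⟩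
  · linarith [h1 k]
  · linarith [h2 k]
  · have := norm_sub_norm_le (E k).1 (H k).1
    rw [norm_sub_rev] at this
    linarith [h1 k, hd1 k]
  · have := norm_sub_norm_le (E k).2 (H k).2
    rw [norm_sub_rev] at this
    linarith [h2 k, hd2 k]
  · nlinarith [h1' k, norm_nonneg (H k).1]
  · have := norm_sub_norm_le (H k).1 (E k).1
    have hle : ‖(H k).1‖ - 1 / X ≤ ‖(E k).1‖ := by linarith [hd1 k]
    have hKX' : K * (1 / X) ≤ K * (K * (1 / X)) :=
      le_mul_of_one_le_left (by positivity) (by linarith : 1 ≤ K)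
    nlinarith [h1' k, mul_le_mul_of_nonneg_left hle hK0.le]
  · nlinarith [norm_nonneg (cross (H 0) (H 1))]
  · rw [hcr]
    have := norm_sub_norm_le (cross (H k) (H (1 - k))) (cross (H k) (H (1 - k) - E (1 - k)))
    nlinarith [hcc k, hdiff k (1 - k)]
  -- Zero-forcing along the true channel would leave nothing, so only the estimation error leaks.
  · rw [hcr, show cross (H k) (H k) = 0 by simp only [cross]; ring, zero_sub, norm_neg]
    calc X * ‖cross (H k) (H k - E k)‖ ≤ X * (K * (1 / X)) := by gcongr; exact hdiff k k
      _ = K := by field_simp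
      _ ≤ K ^ 2 := le_self_pow₀ (by linarith) (by norm_num)

/-- Without channel estimates, the second beam serves as zero-forcing direction. -/
lemma wellConditioned_const {K : ℝ} {H : Fin 2 → ℂ × ℂ} (hK : 1 ≤ K)
    (h1 : ∀ k, ‖(H k).1‖ ≤ K) (h2 : ∀ k, ‖(H k).2‖ ≤ K) (h1' : ∀ k, 1 ≤ K * ‖(H k).1‖)
    (h2' : ∀ k, 1 ≤ K * ‖(H k).2‖) (hc : 1 ≤ K * ‖cross (H 0) (H 1)‖) :
    WellConditioned K 1 H fun _ => (1, 0) where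
  fst_le := h1
  snd_le := h2
  est_fst_le _ := by simpa using hK
  est_snd_le _ := by simpa using zero_le_one.trans hK
  fst_ge := h1'
  est_fst_ge _ := by simpa using hK
  cross_ge := hc
  direct_ge k := by simpa [cross] using h2' k
  leak_le k := by
    simpa [cross] using (h2 k).trans (le_self_pow₀ hK (by norm_num))

section
variable {Ω : Type*} [MeasurableSpace Ω] {μ : Measure Ω} [IsProbabilityMeasure μ] {m : ℕ}
  {S : ℕ → Ω → State m} {a b : Fin m → ℂ}

/-- The effective channels are bounded, and bounded away from degeneracy. -/
lemma withHighProb_effective (hS : ∀ t, Measurable (S t)) {t : ℕ}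
    (hab : ∀ᵐ ω ∂μ, (∀ k, (effective a b (S t ω) k).1 ≠ 0) ∧
      (∀ k, (effective a b (S t ω) k).2 ≠ 0) ∧
      cross (effective a b (S t ω) 0) (effective a b (S t ω) 1) ≠ 0)
    {K : ℝ → ℝ} (hK : Tendsto K atTop atTop) :
    WithHighProb μ fun P ω =>
      (∀ k, ‖(effective a b (S t ω) k).1‖ ≤ K P ∧ ‖(effective a b (S t ω) k).2‖ ≤ K P ∧
        1 ≤ K P * ‖(effective a b (S t ω) k).1‖ ∧ 1 ≤ K P * ‖(effective a b (S t ω) k).2‖) ∧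
      1 ≤ K P * ‖cross (effective a b (S t ω) 0) (effective a b (S t ω) 1)‖ := by
  have he : ∀ k, Measurable fun ω => effective a b (S t ω) k :=
    measurable_pi_iff.1 ((measurable_effective a b).comp (hS t))
  refine WithHighProb.and (WithHighProb.forall fun k => ?_) ?_
  · exact (withHighProb_le (he k).fst.norm hK).and ((withHighProb_le (he k).snd.norm hK).and
      ((withHighProb_ge (he k).fst (hab.mono fun ω h => h.1 k) hK).and
        (withHighProb_ge (he k).snd (hab.mono fun ω h => h.2.1 k) hK)))
  · refine withHighProb_ge ?_ (hab.mono fun ω h => h.2.2) hK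
    have h0 := he 0
    have h1 := he 1
    unfold cross
    fun_prop

lemma effective_sub (s s' : State m) (k : Fin 2) :
    effective a b s k - effective a b s' k =
      (∑ i, (s k i - s' k i) * a i, ∑ i, (s k i - s' k i) * b i) := by
  simp [effective, sub_mul, Finset.sum_sub_distrib]

lemma norm_sum_mul_le {x c : Fin m → ℂ} {K X : ℝ} (hK : 0 < K) (hX : 0 < X)
    (hx : ∀ i, ‖x i‖ ≤ 1 / (X * K)) (hc : ∑ i, ‖c i‖ ≤ K) : ‖∑ i, x i * c i‖ ≤ 1 / X := by
  calc ‖∑ i, x i * c i‖ ≤ ∑ i, ‖x i * c i‖ := norm_sum_le _ _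
    _ ≤ ∑ i, 1 / (X * K) * ‖c i‖ := by
        refine Finset.sum_le_sum fun i _ => ?_
        rw [norm_mul]; gcongr; exact hx i
    _ = 1 / (X * K) * ∑ i, ‖c i‖ := by rw [Finset.mul_sum]
    _ ≤ 1 / (X * K) * K := by gcongr
    _ = 1 / X := by field_simp

lemma lt_rpow_of_lt_errorExponent {v P γ : ℝ} (hv : 0 ≤ v) (hP : 1 < P)
    (h : (γ : EReal) < errorExponent v P) : v < P ^ (-γ) := by
  unfold errorExponent at h
  split_ifs at h with h0
  · rw [h0]; positivity
  · have hv' : 0 < v := lt_of_le_of_ne hv (Ne.symm h0)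
    rw [EReal.coe_lt_coe_iff, lt_div_iff₀ (Real.log_pos hP)] at h
    rw [Real.lt_rpow_iff_log_lt hv' (by linarith)]
    linarith

end

section
variable {Ω : Type*} [MeasurableSpace Ω] {μ : Measure Ω} {m : ℕ} {S : ℕ → Ω → State m}
  {a b : Fin m → ℂ}

/-- Chebyshev's inequality: the variance is below `P ^ (-(β + 4 * ε))` and the squared threshold is
`P ^ (-(β + 2 * ε))`, so the failure probability is at most `P ^ (-(2 * ε))`. -/
lemma withHighProb_error_le {Shat : ℝ → ℕ → Ω → State m} {σ2 : ℝ → ℝ} {α : EReal}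
    (hShat : ∀ P : ℝ, 0 < P → ImperfectEstimate μ S (Shat P) (σ2 P))
    (hα : Tendsto (fun P => errorExponent (σ2 P) P) atTop (𝓝 α)) {β ε : ℝ} (hε : 0 < ε)
    (hβ : ((β + 4 * ε : ℝ) : EReal) < α) (t : ℕ) (k : Fin 2) (i : Fin m) :
    WithHighProb μ fun P ω => ‖S t ω k i - Shat P t ω k i‖ ≤ 1 / (P ^ (β / 2) * P ^ ε) := by
  have hlim : Tendsto (fun P : ℝ => ENNReal.ofReal (P ^ (-(2 * ε)))) atTop (𝓝 0) := by
    simpa using ENNReal.tendsto_ofReal (tendsto_rpow_neg_atTop (by positivity : 0 < 2 * ε))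
  refine tendsto_of_tendsto_of_tendsto_of_le_of_le' tendsto_const_nhds hlim
    (Eventually.of_forall fun _ => zero_le) ?_
  filter_upwards [hα.eventually (lt_mem_nhds hβ), eventually_gt_atTop 1] with P hP hP1
  have hP0 : 0 < P := by linarith
  have hI := hShat P hP0
  have hcov := (hI.error t k).cov i i
  rw [if_pos rfl] at hcov
  refine (measure_norm_gt_le ((hI.error t k).memLp i) hcov (by positivity)).trans
    (ENNReal.ofReal_le_ofReal ?_)
  calc σ2 P / (1 / (P ^ (β / 2) * P ^ ε)) ^ 2 = σ2 P * (P ^ (β / 2) * P ^ ε) ^ 2 := by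
        field_simp
    _ ≤ P ^ (-(β + 4 * ε)) * (P ^ (β / 2) * P ^ ε) ^ 2 := by
        gcongr
        exact (lt_rpow_of_lt_errorExponent hI.nonneg hP1 hP).le
    _ = P ^ (-(2 * ε)) := by
        rw [← Real.rpow_add hP0, ← Real.rpow_natCast, ← Real.rpow_mul hP0.le,
          ← Real.rpow_add hP0]
        congr 1
        push_cast
        ring

/-- With current channel knowledge of exponent above `β`, or with `β = 0`, some measurable
function of the estimates makes the effective channels well conditioned. -/
lemma exists_estimator [IsProbabilityMeasure μ] (hS : ∀ t, Measurable (S t))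
    (hab : ∀ t, ∀ᵐ ω ∂μ, (∀ k, (effective a b (S t ω) k).1 ≠ 0) ∧
      (∀ k, (effective a b (S t ω) k).2 ≠ 0) ∧
      cross (effective a b (S t ω) 0) (effective a b (S t ω) 1) ≠ 0)
    {Shat : ℝ → ℕ → Ω → State m} {σ2 : ℝ → ℝ} {α : EReal}
    (hShat : ∀ P : ℝ, 0 < P → ImperfectEstimate μ S (Shat P) (σ2 P))
    (hα : Tendsto (fun P => errorExponent (σ2 P) P) atTop (𝓝 α)) {β ε : ℝ} (hε : 0 < ε)
    (hβ : β = 0 ∨ 4 * ε < β / 2 ∧ ((β + 4 * ε : ℝ) : EReal) < α) :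
    ∃ est : State m → Fin 2 → ℂ × ℂ, Measurable est ∧ WithHighProb μ fun P ω =>
      ∀ t : Fin 3, WellConditioned (P ^ ε) (P ^ (β / 2)) (effective a b (S t ω))
        (est (Shat P t ω)) := by
  have hKlim : Tendsto (fun P : ℝ => P ^ ε) atTop atTop := tendsto_rpow_atTop hε
  rcases hβ with rfl | ⟨hεβ, hβ⟩
  -- For `β = 0` the estimates may carry no information and are discarded. Here `X = 1`, so a
  -- bounded leakage bound is all that is required.
  · refine ⟨fun _ _ => (1, 0), measurable_const, WithHighProb.forall fun t => ?_⟩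
    refine (withHighProb_effective hS (hab t) hKlim).mono ?_
    filter_upwards [eventually_ge_atTop 1] with P hP ω h
    rw [zero_div, Real.rpow_zero]
    exact wellConditioned_const (Real.one_le_rpow hP hε.le) (fun k => (h.1 k).1)
      (fun k => (h.1 k).2.1) (fun k => (h.1 k).2.2.1) (fun k => (h.1 k).2.2.2) h.2
  · refine ⟨effective a b, measurable_effective a b, WithHighProb.forall fun t => ?_⟩
    have herr : WithHighProb μ fun P ω => ∀ k i,
        ‖S t ω k i - Shat P t ω k i‖ ≤ 1 / (P ^ (β / 2) * P ^ ε) :=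
      WithHighProb.forall fun k => WithHighProb.forall fun i =>
        withHighProb_error_le hShat hα hε hβ t k i
    refine ((withHighProb_effective hS (hab t) (hKlim.atTop_div_const two_pos)).and herr).mono ?_
    filter_upwards [eventually_ge_atTop 1, hKlim.eventually_ge_atTop 8,
      hKlim.eventually_ge_atTop (∑ i, ‖a i‖), hKlim.eventually_ge_atTop (∑ i, ‖b i‖)]
      with P hP1 hP8 hPa hPb ω h
    have hP0 : 0 < P := by linarith
    have hX0 : 0 < P ^ (β / 2) := by positivity
    have hK0 : 0 < P ^ ε := by positivity
    refine wellConditioned_of_accurate hP8 ?_ (fun k => (h.1.1 k).1) (fun k => (h.1.1 k).2.1)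
      (fun k => (h.1.1 k).2.2.1) h.1.2 (fun k => ?_) (fun k => ?_)
    -- The condition `4 * ε < β / 2` enters here: `2 * K ^ 2 ≤ K ^ 4 ≤ X`.
    · have h2 : 2 ≤ (P ^ ε) ^ 2 := by nlinarith
      calc 2 * (P ^ ε) ^ 2 ≤ (P ^ ε) ^ 2 * (P ^ ε) ^ 2 := by gcongr
        _ = (P ^ ε) ^ 4 := by ring
        _ = P ^ (4 * ε) := by
          rw [← Real.rpow_natCast, ← Real.rpow_mul hP0.le]; congr 1; push_cast; ring
        _ ≤ P ^ (β / 2) := Real.rpow_le_rpow_of_exponent_le hP1 hεβ.le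
    · rw [effective_sub]
      exact norm_sum_mul_le hK0 hX0 (h.2 k) hPa
    · rw [effective_sub]
      exact norm_sum_mul_le hK0 hX0 (h.2 k) hPb

end

/-! ### Constellations and rates -/

/-- Square constellations: a message is mapped injectively to four Gaussian integers. -/
lemma exists_constellation (Q : Fin 4 → ℕ) :
    ∃ sym : Fin (∏ i, (Q i + 1) ^ 2) → Fin 4 → GaussianInt, Function.Injective sym ∧
      ∀ w i, ‖(sym w i : ℂ)‖ ≤ 2 * Q i := by
  let e : Fin (∏ i, (Q i + 1) ^ 2) ≃ ((i : Fin 4) → Fin (Q i + 1) × Fin (Q i + 1)) :=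
    (Fintype.equivFinOfCardEq (by simp [Fintype.card_pi, sq])).symm
  refine ⟨fun w i => ⟨((e w i).1 : ℕ), ((e w i).2 : ℕ)⟩, fun w v h => ?_, fun w i => ?_⟩
  · refine e.injective (funext fun i => ?_)
    have hi := congrFun h i
    simp only [Zsqrtd.ext_iff, Nat.cast_inj] at hi
    exact Prod.ext (Fin.ext hi.1) (Fin.ext hi.2)
  · refine (Complex.norm_le_abs_re_add_abs_im _).trans ?_
    rw [GaussianInt.re_toComplex, GaussianInt.im_toComplex]
    have h1 : (((e w i).1 : ℕ) : ℝ) ≤ Q i := by exact_mod_cast Nat.le_of_lt_succ (e w i).1.2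
    have h2 : (((e w i).2 : ℕ) : ℝ) ≤ Q i := by exact_mod_cast Nat.le_of_lt_succ (e w i).2.2
    push_cast
    rw [abs_of_nonneg (by positivity), abs_of_nonneg (by positivity)]
    linarith

/-- A negative exponent eventually leaves a one-point constellation, which carries no rate; hence
the truncation at zero. -/
lemma tendsto_log_floor_rpow (e : ℝ) :
    Tendsto (fun P : ℝ => Real.log ((⌊P ^ e⌋₊ + 1 : ℕ) : ℝ) / Real.log P) atTop
      (𝓝 (max e 0)) := by
  have hup : Tendsto (fun P : ℝ => max e 0 + Real.log 2 / Real.log P) atTop (𝓝 (max e 0)) := by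
    simpa using tendsto_const_nhds.add (Real.tendsto_log_atTop.const_div_atTop (Real.log 2))
  refine tendsto_of_tendsto_of_tendsto_of_le_of_le' tendsto_const_nhds hup ?_ ?_
  · filter_upwards [eventually_gt_atTop 1] with P hP
    have hP0 : 0 < P := by linarith
    rw [le_div_iff₀ (Real.log_pos hP), ← Real.log_rpow hP0]
    refine Real.log_le_log (by positivity) ?_
    push_cast
    rcases le_total e 0 with he | he
    · rw [max_eq_right he, Real.rpow_zero]
      linarith [Nat.cast_nonneg (α := ℝ) ⌊P ^ e⌋₊]
    · rw [max_eq_left he]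
      exact (Nat.lt_floor_add_one _).le
  · filter_upwards [eventually_gt_atTop 1] with P hP
    have hP0 : 0 < P := by linarith
    have hl := Real.log_pos hP
    rw [div_le_iff₀ hl, add_mul, div_mul_cancel₀ _ hl.ne', ← Real.log_rpow hP0,
      ← Real.log_mul (by positivity) (by positivity)]
    refine Real.log_le_log (by positivity) ?_
    push_cast
    have h1 : (⌊P ^ e⌋₊ : ℝ) ≤ P ^ e := Nat.floor_le (by positivity)
    have h2 : P ^ e ≤ P ^ max e 0 := Real.rpow_le_rpow_of_exponent_le hP.le (le_max_left _ _)
    have h3 : 1 ≤ P ^ max e 0 := Real.one_le_rpow hP.le (le_max_right _ _)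
    linarith

lemma tendsto_rate (e : Fin 4 → ℝ) :
    Tendsto (fun P : ℝ => (Real.logb 2 ((∏ i, (⌊P ^ e i⌋₊ + 1) ^ 2 : ℕ) : ℝ) / (3 : ℕ))
      / Real.logb 2 P) atTop (𝓝 ((∑ i, 2 * max (e i) 0) / 3)) := by
  have h : Tendsto (fun P : ℝ => (∑ i, 2 * (Real.log ((⌊P ^ e i⌋₊ + 1 : ℕ) : ℝ) / Real.log P)) / 3)
      atTop (𝓝 ((∑ i, 2 * max (e i) 0) / 3)) :=
    (tendsto_finsetSum _ fun i _ => (tendsto_log_floor_rpow (e i)).const_mul 2).div_const 3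
  refine h.congr fun P => ?_
  have hlog : Real.log ((∏ i, (⌊P ^ e i⌋₊ + 1) ^ 2 : ℕ) : ℝ)
      = ∑ i, 2 * Real.log ((⌊P ^ e i⌋₊ + 1 : ℕ) : ℝ) := by
    rw [Nat.cast_prod, Real.log_prod fun i _ => by positivity]
    refine Finset.sum_congr rfl fun i _ => ?_
    rw [Nat.cast_pow, Real.log_pow]; norm_num
  rw [Real.logb, Real.logb, hlog]
  have h2 : Real.log 2 ≠ 0 := (Real.log_pos one_lt_two).ne'
  simp only [← mul_div_assoc, ← Finset.sum_div]
  push_cast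
  rw [div_right_comm _ (Real.log P) 3, div_right_comm _ (Real.log 2) 3,
    div_div_div_cancel_right₀ h2]

/-! ### Achievability -/

/-- The exponents of the constellation sizes. -/
def symbolExponent (β ε : ℝ) : Fin 4 → ℝ :=
  ![1 / 2 - 16 * ε, (1 - β) / 2 - 16 * ε, β / 2 - 16 * ε, β / 2 - 16 * ε]

lemma two_mul_rpow_sub_sixteen {P : ℝ} (hP : 0 < P) (x ε : ℝ) :
    2 * P ^ (x - 16 * ε) = 2 * P ^ x / (P ^ ε) ^ 16 := by
  rw [Real.rpow_sub hP, ← Real.rpow_natCast (P ^ ε), ← Real.rpow_mul hP.le, mul_div_assoc]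
  norm_num [mul_comm]

lemma symbolBound_of_norm_le {P β ε : ℝ} (hP : 0 < P) {z : Fin 2 → Fin 4 → GaussianInt}
    (hz : ∀ l i, ‖(z l i : ℂ)‖ ≤ 2 * P ^ symbolExponent β ε i) :
    SymbolBound (P ^ ε) (P ^ (β / 2)) (P ^ ((1 - β) / 2)) z where
  forced l := by
    rw [← Real.rpow_add hP, ← two_mul_rpow_sub_sixteen hP]
    refine (hz l 0).trans_eq ?_
    simp only [symbolExponent, Matrix.cons_val_zero]
    congr 2
    ring
  free l := by
    rw [← two_mul_rpow_sub_sixteen hP]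
    exact hz l 1
  layered l j := by
    rw [← two_mul_rpow_sub_sixteen hP]
    fin_cases j
    · exact hz l 2
    · exact hz l 3

section
variable {Ω : Type*} [MeasurableSpace Ω] {μ : Measure Ω} [IsProbabilityMeasure μ] {m : ℕ}
  {S : ℕ → Ω → State m} {Shat : ℝ → ℕ → Ω → State m} {σ2 : ℝ → ℝ} {α : EReal}

lemma reliablePrelog_scheme (hS : IndependentFading μ S)
    (hShat : ∀ P : ℝ, 0 < P → ImperfectEstimate μ S (Shat P) (σ2 P))
    (hα : Tendsto (fun P => errorExponent (σ2 P) P) atTop (𝓝 α)) {β ε : ℝ} (hε : 0 < ε)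
    (hβ0 : 0 ≤ β) (hβ1 : 8 * ε ≤ (1 - β) / 2)
    (hβ : β = 0 ∨ 4 * ε < β / 2 ∧ ((β + 4 * ε : ℝ) : EReal) < α) :
    ReliablePrelog μ S Shat 3 ((∑ i, 2 * max (symbolExponent β ε i) 0) / 3) := by
  obtain ⟨a, b, hab⟩ := hS.exists_beams
  obtain ⟨est, hest, hwhp⟩ := exists_estimator hS.measurable hab hShat hα hε hβ
  let Q : ℝ → Fin 4 → ℕ := fun P i => ⌊P ^ symbolExponent β ε i⌋₊
  have hM : ∀ P, 0 < ∏ i, (Q P i + 1) ^ 2 := fun P => Finset.prod_pos fun i _ => by positivity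
  have hM' : ∀ P, NeZero (∏ i, (Q P i + 1) ^ 2) := fun P => ⟨(hM P).ne'⟩
  choose sym hsym hnorm using fun P => exists_constellation (Q P)
  choose c hpow hdec using fun P : ℝ => exists_scheme_code (P := P) (K := P ^ ε)
    (X := P ^ (β / 2)) (Y := P ^ ((1 - β) / 2)) a b hest (hsym P)
  refine ⟨fun P => ∏ i, (Q P i + 1) ^ 2, c, fun P _ => hM P,
    fun P hP t => hpow P hP.le μ S (Shat P) t, tendsto_rate _, ?_⟩
  have hKlim : Tendsto (fun P : ℝ => P ^ ε) atTop atTop := tendsto_rpow_atTop hε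
  have hnoise : WithHighProb (noiseLaw 3) fun P n => ∀ k t, ‖n k t‖ ≤ P ^ ε :=
    WithHighProb.forall fun k => WithHighProb.forall fun t => withHighProb_le (by fun_prop) hKlim
  have hsum := hwhp.add hnoise
  rw [add_zero] at hsum
  refine tendsto_of_tendsto_of_tendsto_of_le_of_le' tendsto_const_nhds hsum
    (Eventually.of_forall fun _ => zero_le) ?_
  filter_upwards [eventually_ge_atTop 1, hKlim.eventually_ge_atTop 8,
    hKlim.eventually_ge_atTop (∑ i, (‖a i‖ + ‖b i‖) ^ 2)] with P hP1 hP8 hPab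
  have hP0 : 0 < P := by linarith
  have hset : {n : Fin 2 → Fin 3 → ℂ | ¬ ∀ k t, ‖n k t‖ ≤ P ^ ε}
      = {n | ∃ k t, P ^ ε < ‖n k t‖} := by
    ext n; simp only [Set.mem_ofPred_eq, not_forall, not_le]
  rw [hset]
  refine (c P).errorProb_le μ S (Shat P) _ (P ^ ε) fun ω hω w n k hn => ?_
  simp only [Set.mem_ofPred_eq, not_not] at hω
  refine hdec P hP8 (Real.one_le_rpow hP1 (by linarith)) ?_ ?_ ?_ ?_ _ _ hω w n k hn
  · rw [← Real.rpow_natCast, ← Real.rpow_mul hP0.le]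
    refine Real.rpow_le_rpow_of_exponent_le hP1 ?_
    push_cast
    linarith
  · rw [← Real.rpow_add hP0, ← Real.rpow_natCast, ← Real.rpow_mul hP0.le]
    refine le_of_eq ?_
    rw [show (β / 2 + (1 - β) / 2) * ((2 : ℕ) : ℝ) = 1 by push_cast; ring, Real.rpow_one]
  · exact hPab.trans (le_self_pow₀ (by linarith) (by norm_num))
  · intro w
    refine symbolBound_of_norm_le hP0 fun l i => (hnorm P (w l) i).trans ?_
    gcongr
    exact Nat.floor_le (by positivity)

lemma le_sum_symbolExponent (β ε : ℝ) :
    (2 + β - 128 * ε) / 3 ≤ (∑ i, 2 * max (symbolExponent β ε i) 0) / 3 := by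
  have h : 2 + β - 128 * ε = ∑ i, 2 * symbolExponent β ε i := by
    simp [symbolExponent, Fin.sum_univ_four]; ring
  rw [h]
  gcongr
  exact le_max_left _ _

/-- The margin between `β` and `α`, and between `β` and 1, leaves room for a small slack `ε`. Its
rate loss vanishes as `ε → 0` because the blocklength stays 3 and `dof` is a supremum. -/
lemma le_dof_of_lt (hS : IndependentFading μ S)
    (hShat : ∀ P : ℝ, 0 < P → ImperfectEstimate μ S (Shat P) (σ2 P))
    (hα : Tendsto (fun P => errorExponent (σ2 P) P) atTop (𝓝 α)) {β : ℝ}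
    (hβ0 : 0 ≤ β) (hβ1 : β < 1) (hβ : β = 0 ∨ (β : EReal) < α) :
    (((2 + β) / 3 : ℝ) : EReal) ≤ dof μ S Shat 3 := by
  have hlim : Tendsto (fun ε : ℝ => (((2 + β - 128 * ε) / 3 : ℝ) : EReal)) (𝓝[>] 0)
      (𝓝 (((2 + β) / 3 : ℝ) : EReal)) := by
    refine (continuous_coe_real_ereal.tendsto _).comp ?_
    have : Continuous fun ε : ℝ => (2 + β - 128 * ε) / 3 := by fun_prop
    simpa using (this.tendsto 0).mono_left nhdsWithin_le_nhds
  have hsmall : ∀ {f : ℝ → ℝ} {c : ℝ}, Continuous f → f 0 < c → ∀ᶠ ε in 𝓝[>] (0 : ℝ), f ε < c :=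
    fun hf h => nhdsWithin_le_nhds ((hf.tendsto 0).eventually (gt_mem_nhds h))
  have hev : ∀ᶠ ε in 𝓝[>] (0 : ℝ),
      β = 0 ∨ 4 * ε < β / 2 ∧ ((β + 4 * ε : ℝ) : EReal) < α := by
    rcases hβ with h | h
    · exact Eventually.of_forall fun _ => Or.inl h
    · rcases hβ0.eq_or_lt with h0 | h0
      · exact Eventually.of_forall fun _ => Or.inl h0.symm
      · have h1 : ∀ᶠ ε in 𝓝[>] (0 : ℝ), 4 * ε < β / 2 := hsmall (by fun_prop) (by linarith)
        have hc : Continuous fun ε : ℝ => ((β + 4 * ε : ℝ) : EReal) :=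
          continuous_coe_real_ereal.comp (by fun_prop)
        have h2 : ∀ᶠ ε in 𝓝[>] (0 : ℝ), ((β + 4 * ε : ℝ) : EReal) < α :=
          nhdsWithin_le_nhds ((hc.tendsto 0).eventually (gt_mem_nhds (by simpa using h)))
        exact (h1.and h2).mono fun _ => Or.inr
  refine le_of_tendsto hlim ?_
  filter_upwards [self_mem_nhdsWithin, hev,
    hsmall (f := fun ε => 8 * ε) (c := (1 - β) / 2) (by fun_prop) (by linarith)] with ε h0 h1 h2
  refine le_trans (EReal.coe_le_coe_iff.2 (le_sum_symbolExponent β ε)) (le_sSup ?_)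
  exact ⟨_, reliablePrelog_scheme hS hShat hα h0 hβ0 h2.le h1, rfl⟩

/-- The three-slot codes have at least `(2 + β) / 3` degrees of freedom per user for every `β` in
the unit interval that the error exponent `α` attains. -/
lemma le_dof (hS : IndependentFading μ S)
    (hShat : ∀ P : ℝ, 0 < P → ImperfectEstimate μ S (Shat P) (σ2 P))
    (hα : Tendsto (fun P => errorExponent (σ2 P) P) atTop (𝓝 α)) {β : ℝ}
    (hβ0 : 0 ≤ β) (hβ1 : β ≤ 1) (hβ : (β : EReal) ≤ α) :
    (((2 + β) / 3 : ℝ) : EReal) ≤ dof μ S Shat 3 := by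
  -- Approaching `β` from below through nonnegative exponents is impossible at `β = 0`, where the
  -- scheme without estimates is used directly.
  rcases hβ0.eq_or_lt with rfl | hpos
  · exact le_dof_of_lt hS hShat hα le_rfl one_pos (Or.inl rfl)
  have hlim : Tendsto (fun γ : ℝ => (((2 + γ) / 3 : ℝ) : EReal)) (𝓝[<] β)
      (𝓝 (((2 + β) / 3 : ℝ) : EReal)) := by
    refine (continuous_coe_real_ereal.tendsto _).comp ?_
    have : Continuous fun γ : ℝ => (2 + γ) / 3 := by fun_prop
    exact (this.tendsto β).mono_left nhdsWithin_le_nhds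
  refine le_of_tendsto hlim ?_
  filter_upwards [self_mem_nhdsWithin, nhdsWithin_le_nhds (lt_mem_nhds hpos)] with γ h1 h0
  exact le_dof_of_lt hS hShat hα h0.le (lt_of_lt_of_le h1 hβ1)
    (Or.inr (lt_of_lt_of_le (EReal.coe_lt_coe_iff.2 h1) hβ))

end

end MISO

end

theorem theorem1 {Ω : Type*} [MeasurableSpace Ω] (μ : Measure Ω) [IsProbabilityMeasure μ]
    (m : ℕ) (S : ℕ → Ω → MISO.State m) (Shat : ℝ → ℕ → Ω → MISO.State m)
    (σ2 : ℝ → ℝ) (α : EReal)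
    (hS : MISO.IndependentFading μ S)
    (hShat : ∀ P : ℝ, 0 < P → MISO.ImperfectEstimate μ S (Shat P) (σ2 P))
    (hα : Tendsto (fun P => MISO.errorExponent (σ2 P) P) atTop (𝓝 α)) :
    (∀ a : ℝ, α = a → 0 ≤ a → a ≤ 1 →
      MISO.AchievableDoF μ S Shat ((2 - a) / (3 - 2 * a))) ∧
    (1 < α → MISO.AchievableDoF μ S Shat 1) := by
  refine ⟨fun a ha h0 h1 => ⟨3, by norm_num, ?_⟩, fun h => ⟨3, by norm_num, ?_⟩⟩
  · refine le_trans (EReal.coe_le_coe_iff.2 ?_) (MISO.le_dof hS hShat hα h0 h1 ha.ge)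
    -- After clearing denominators, the gap between the two rates is `2 * a * (1 - a) ≥ 0`.
    rw [div_le_div_iff₀ (by linarith) (by norm_num)]
    nlinarith
  · have := MISO.le_dof hS hShat hα zero_le_one le_rfl (by simpa using h.le)
    norm_num at this
    simpa using this
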